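/- Let $p,d,n$ be natural numbers with $n\ge 1$ and $1\le d<p$, and let $\lambda_1\ge\dots\ge\lambda_p>0$, $\Lambda=\operatorname{diag}(\lambda_1,\dots,\lambda_p)$. For $U$ in the orthogonal group $O(p)$ let $\mathbb P_U=\mathcal N(0,U\Lambda U^T)^{\otimes n}$ be the law of $n$ independent observations $X_1,\dots,X_n$ in $\mathbb R^p$, with expectation $\mathbb E_U$. Let $\mathcal P_d$ be the set of orthogonal projections on $\mathbb R^p$ of rank $d$. For $P\in\mathcal P_d$ let $R_U(P)=\mathbb E\|X-PX\|^2$ with $X\sim\mathcal N(0,U\Lambda U^T)$ be the reconstruction error, and let $\mathcal E_U(P)=R_U(P)-\min_{Q\in\mathcal P_d}R_U(Q)$ be the excess risk. Assume that $\lambda_1>\lambda_{d+1}$ and $\lambda_d>\lambda_p$. Let $1\le r\le d$ be the largest natural number such that $\lambda_r>\lambda_{d+1}$, and let $d\le s<p$ be the smallest natural number such that $\lambda_d>\lambda_{s+1}$. Then, for every $\mu\in[\lambda_{d+1},\lambda_d]$, $$\inf_{\hat P}\int_{O(p)}\mathbb E_U\,\mathcal E_U(\hat P)\,dU\ \ge\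 J_\mu ,$$ where the infimum is over all $\mathcal P_d$-valued (measurable) estimators $\hat P=\hat P(X_1,\dots,X_n)$, $dU$ is the normalized Haar measure on $O(p)$, the integrals exist and are finite, and $$J_\mu=\frac13\max\Big\{\sum_{i=1}^{r}\sum_{j=s+1}^{p}x_{ij}\Big\},$$ the maximum (which is attained) being over all real arrays $(x_{ij})_{1\le i\le r,\ s<j\le p}$ such that $$0\le x_{ij}\le\frac1n\,\frac{\lambda_i\lambda_j}{\lambda_i-\lambda_j}\quad(i\le r,\ j>s),\qquad \sum_{i=1}^{r}x_{ij}\le\mu-\lambda_j\quad(j>s),\qquad \sum_{j=s+1}^{p}x_{ij}\le\lambda_i-\mu\quad(i\le r).$$ -/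

import Mathlib

open MeasureTheory ProbabilityTheory

noncomputable section

namespace GaussianPCA

/-- The space `ℝ^p` with its Euclidean norm. -/
abbrev Vec (p : ℕ) : Type := EuclideanSpace ℝ (Fin p)

/-- Real `p × p` matrices. -/
abbrev Mat (p : ℕ) : Type := Matrix (Fin p) (Fin p) ℝ

/-- The orthogonal group `O(p)`, with the subspace topology of `ℝ^{p × p}`. -/
abbrev OGroup (p : ℕ) : Type := Matrix.orthogonalGroup (Fin p) ℝ

/-- Matrices carry the product (equivalently, Borel) sigma-algebra. -/
instance matMeasurableSpace (p : ℕ) : MeasurableSpace (Mat p) :=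
  inferInstanceAs (MeasurableSpace (Fin p → Fin p → ℝ))

instance matBorelSpace (p : ℕ) : BorelSpace (Mat p) :=
  inferInstanceAs (BorelSpace (Fin p → Fin p → ℝ))

instance oGroupCompactSpace (p : ℕ) : CompactSpace (OGroup p) := by
  have hclosed : IsClosed ((Matrix.orthogonalGroup (Fin p) ℝ : Set (Mat p))) := by
    have h : (Matrix.orthogonalGroup (Fin p) ℝ : Set (Mat p)) = {U : Mat p | U * star U = 1} := by
      ext U
      exact Matrix.mem_orthogonalGroup_iff (Fin p) ℝ
    rw [h]
    exact isClosed_eq (by fun_prop) continuous_const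
  have hcompact : IsCompact {U : Fin p → Fin p → ℝ | ∀ i, U i ∈
      {v : Fin p → ℝ | ∀ j, v j ∈ Set.Icc (-1 : ℝ) 1}} :=
    isCompact_pi_infinite fun _ => isCompact_pi_infinite fun _ => isCompact_Icc
  refine isCompact_iff_compactSpace.mp (IsCompact.of_isClosed_subset hcompact hclosed ?_)
  intro U hU i j
  have h := entry_norm_bound_of_unitary (𝕜 := ℝ) hU i j
  exact abs_le.mp h

/-- The normalized Haar measure `dU` on the compact group `O(p)`, of total mass `1`. -/
def haarO (p : ℕ) : Measure (OGroup p) :=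
  Measure.haarMeasure (⊤ : TopologicalSpace.PositiveCompacts (OGroup p))

/-- The covariance matrix `U Λ Uᵀ` with `Λ = diag(lam 1, …, lam p)`. Eigenvalues are numbered from
`1`; the values of `lam` outside `1, …, p` play no role. -/
def covMat {p : ℕ} (lam : ℕ → ℝ) (U : OGroup p) : Mat p :=
  (U : Mat p) * Matrix.diagonal (fun k : Fin p => lam (k.val + 1)) * (U : Mat p).transpose

/-- The law `N(0, U Λ Uᵀ)` on `ℝ^p`. -/
def gaussianLaw {p : ℕ} (lam : ℕ → ℝ) (U : OGroup p) : Measure (Vec p) :=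
  multivariateGaussian 0 (covMat lam U)

/-- The law `ℙ_U = N(0, U Λ Uᵀ)^{⊗ n}` of `n` independent observations. -/
def sampleLaw {p : ℕ} (n : ℕ) (lam : ℕ → ℝ) (U : OGroup p) : Measure (Fin n → Vec p) :=
  Measure.pi fun _ => gaussianLaw lam U

/-- The set `𝒫_d` of orthogonal projections of `ℝ^p` of rank `d`, as matrices. -/
def projections (p d : ℕ) : Set (Mat p) :=
  {P | IsStarProjection P ∧ P.rank = d}

/-- The reconstruction error `R_U(P) = 𝔼_U ‖X - P X‖²`, where `X ∼ N(0, U Λ Uᵀ)`. -/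
def reconstructionError {p : ℕ} (lam : ℕ → ℝ) (U : OGroup p) (P : Mat p) : ℝ :=
  ∫ x, ‖x - Matrix.toEuclideanLin P x‖ ^ 2 ∂(gaussianLaw lam U)

/-- The excess risk `𝓔_U(P) = R_U(P) - min_{Q ∈ 𝒫_d} R_U(Q)`. -/
def excessRisk {p : ℕ} (d : ℕ) (lam : ℕ → ℝ) (U : OGroup p) (P : Mat p) : ℝ :=
  reconstructionError lam U P - sInf (reconstructionError lam U '' projections p d)

/-- `𝒫_d`-valued estimators: measurable functions of the sample `(X_1, …, X_n)`. -/
def Estimator (p d n : ℕ) : Type :=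
  {f : (Fin n → Vec p) → Mat p // Measurable f ∧ ∀ X, f X ∈ projections p d}

/-- The expected excess risk `𝔼_U 𝓔_U(P̂)`. -/
def expectedExcessRisk {p d n : ℕ} (lam : ℕ → ℝ) (Phat : Estimator p d n) (U : OGroup p) : ℝ :=
  ∫ X, excessRisk d lam U (Phat.1 X) ∂(sampleLaw n lam U)

/-- The Haar-averaged risk `∫_{O(p)} 𝔼_U 𝓔_U(P̂) dU`. -/
def averagedExcessRisk {p d n : ℕ} (lam : ℕ → ℝ) (Phat : Estimator p d n) : ℝ :=
  ∫ U, expectedExcessRisk lam Phat U ∂(haarO p)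

/-- The array `(x_ij)`, `1 ≤ i ≤ r`, `s < j ≤ p`, satisfies the constraints that define `J_μ`. -/
structure Feasible (p n r s : ℕ) (lam : ℕ → ℝ) (μ : ℝ) (x : ℕ → ℕ → ℝ) : Prop where
  nonneg : ∀ i ∈ Finset.Icc 1 r, ∀ j ∈ Finset.Ioc s p, 0 ≤ x i j
  le_bound : ∀ i ∈ Finset.Icc 1 r, ∀ j ∈ Finset.Ioc s p,
    x i j ≤ 1 / (n : ℝ) * (lam i * lam j / (lam i - lam j))
  col_sum_le : ∀ j ∈ Finset.Ioc s p, ∑ i ∈ Finset.Icc 1 r, x i j ≤ μ - lam j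
  row_sum_le : ∀ i ∈ Finset.Icc 1 r, ∑ j ∈ Finset.Ioc s p, x i j ≤ lam i - μ

/-- The values `∑_{i ≤ r} ∑_{j > s} x_ij` over all feasible arrays; `J_μ` is one third of the
maximum of this set. -/
def objectiveValues (p n r s : ℕ) (lam : ℕ → ℝ) (μ : ℝ) : Set ℝ :=
  {v | ∃ x : ℕ → ℕ → ℝ, Feasible p n r s lam μ x ∧
    v = ∑ i ∈ Finset.Icc 1 r, ∑ j ∈ Finset.Ioc s p, x i j}

end GaussianPCA

end

/-! Carried back to the eigenbasis, an estimator becomes the family of projections Q_U(y) = Uᵀ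
P̂(Uy) U, with y distributed as N(0, Λ)^{⊗n} whatever U is. Its Haar average m(y) is equivariant:
m(gy) = g m(y) gᵀ. Since the reconstruction error is affine in the projection, Fubini shows that the
averaged risk depends only on the numbers a_k = 𝔼 m_kk, and everything reduces to constraints on
these numbers.

The first constraint is a Cramér–Rao inequality in the plane of coordinates i, j. By equivariance,
rotating the data by a small angle θ changes m_ij by θ(m_jj - m_ii) to first order, while the χ²
divergence between the rotated and the original law is nκθ² to leading order, with κ = (λ_i -
λ_j)²/(λ_i λ_j). Hence (a_i - a_j)² ≤ nκ 𝔼 m_ij² (`information_inequality`).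

The second constraint comes from the identity ∑_l Q_kl² = Q_kk for projections: with Jensen it
bounds the sum of 𝔼 m_kl² over l ≠ k by both a_k and 1 - a_k (`meanEstimator_sum_sq_le`).

Since ∑ a_k = d, the excess risk is at least ∑_{k≤d} (λ_k - μ)(1 - a_k) + ∑_{k>d} (μ - λ_k) a_k. One
third of this is bounded below through the 𝔼 m_ij², two thirds through the row and column
constraints on x. With t = a_i - a_j, each pair then contributes at least x_ij (t² + 2(1 - t))/3 =
x_ij (1 + (1 - t)²)/3 ≥ x_ij/3 (`sum_feasible_le`). -/

noncomputable section

namespace GaussianPCA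

/-! ### Product densities, Gaussian integrals, Cauchy–Schwarz -/

/-- A finite product of measures with integrable densities has the product density. -/
theorem pi_withDensity_ofReal {ι : Type*} [Fintype ι] {E : ι → Type*}
    [∀ i, MeasurableSpace (E i)] (μ : ∀ i, Measure (E i)) [∀ i, SigmaFinite (μ i)]
    (f : ∀ i, E i → ℝ) (hf : ∀ i x, 0 ≤ f i x) (hint : ∀ i, Integrable (f i) (μ i))
    [∀ i, SigmaFinite ((μ i).withDensity fun x => ENNReal.ofReal (f i x))] :
    Measure.pi (fun i => (μ i).withDensity fun x => ENNReal.ofReal (f i x)) =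
      (Measure.pi μ).withDensity fun x => ENNReal.ofReal (∏ i, f i (x i)) := by
  classical
  refine Measure.pi_eq fun s hs => ?_
  rw [withDensity_apply _ (MeasurableSet.univ_pi hs), Measure.restrict_pi_pi]
  have hintr : ∀ i, Integrable (f i) ((μ i).restrict (s i)) := fun i => (hint i).restrict
  rw [← ofReal_integral_eq_lintegral_ofReal (Integrable.fintype_prod_dep hintr)
    (ae_of_all _ fun x => Finset.prod_nonneg fun i _ => hf i _),
    integral_fintype_prod_eq_prod, ENNReal.ofReal_prod_of_nonneg
      fun i _ => integral_nonneg fun x => hf i x]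
  refine Finset.prod_congr rfl fun i _ => ?_
  rw [withDensity_apply _ (hs i), ofReal_integral_eq_lintegral_ofReal (hintr i)
    (ae_of_all _ fun x => hf i x)]

/-- The exponential of a quadratic polynomial under a centred Gaussian law. -/
theorem integral_exp_quadratic_gaussianReal {v : NNReal} (hv : v ≠ 0) {A : ℝ} (B : ℝ)
    (hA : 2 * v * A < 1) :
    ∫ x, Real.exp (A * x ^ 2 + B * x) ∂(gaussianReal 0 v) =
      (√(1 - 2 * v * A))⁻¹ * Real.exp (v * B ^ 2 / (2 * (1 - 2 * v * A))) := by
  have hv' : (0 : ℝ) < v := by positivity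
  have hD : 0 < 1 - 2 * v * A := by linarith
  set D : ℝ := 1 - 2 * v * A with hDdef
  rw [integral_gaussianReal_eq_integral_smul hv]
  -- Completing the square leaves an unnormalized Gaussian of variance v/D centred at vB/D.
  have key : ∀ x : ℝ, gaussianPDFReal 0 v x • Real.exp (A * x ^ 2 + B * x) =
      ((√(2 * Real.pi * v))⁻¹ * Real.exp (v * B ^ 2 / (2 * D))) *
        Real.exp (-(D / (2 * v)) * (x - v * B / D) ^ 2) := by
    intro x
    rw [gaussianPDFReal, smul_eq_mul, mul_assoc (√(2 * Real.pi * v))⁻¹,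
      mul_assoc (√(2 * Real.pi * v))⁻¹, ← Real.exp_add, ← Real.exp_add]
    congr 2
    have : A = (1 - D) / (2 * v) := by rw [hDdef]; field_simp; ring
    rw [this]
    field_simp
    ring
  simp_rw [key]
  rw [integral_const_mul, integral_sub_right_eq_self (fun x => Real.exp (-(D / (2 * v)) * x ^ 2)),
    integral_gaussian]
  have : Real.pi / (D / (2 * v)) = (2 * Real.pi * v) / D := by field_simp
  rw [this, Real.sqrt_div (by positivity)]
  have h1 : √(2 * Real.pi * v) ≠ 0 := by positivity
  field_simp

/-- The Cauchy–Schwarz inequality for real functions. -/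
theorem sq_integral_mul_le {α : Type*} [MeasurableSpace α] {μ : Measure α} {f g : α → ℝ}
    (hf : Integrable (fun x => f x ^ 2) μ) (hg : Integrable (fun x => g x ^ 2) μ)
    (hfg : Integrable (fun x => f x * g x) μ) :
    (∫ x, f x * g x ∂μ) ^ 2 ≤ (∫ x, f x ^ 2 ∂μ) * ∫ x, g x ^ 2 ∂μ := by
  have h : ∀ t : ℝ, 0 ≤ (∫ x, g x ^ 2 ∂μ) * (t * t) + (2 * ∫ x, f x * g x ∂μ) * t +
      ∫ x, f x ^ 2 ∂μ := by
    intro t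
    have : ∫ x, (f x + t * g x) ^ 2 ∂μ = (∫ x, g x ^ 2 ∂μ) * (t * t) +
        (2 * ∫ x, f x * g x ∂μ) * t + ∫ x, f x ^ 2 ∂μ := by
      have e : ∀ x, (f x + t * g x) ^ 2 = (t * t) * g x ^ 2 + (2 * t) * (f x * g x) + f x ^ 2 :=
        fun x => by ring
      simp_rw [e]
      have h1 : Integrable (fun x => t * t * g x ^ 2) μ := hg.const_mul _
      have h2 : Integrable (fun x => 2 * t * (f x * g x)) μ := hfg.const_mul _
      rw [integral_add (f := fun x => t * t * g x ^ 2 + 2 * t * (f x * g x)) (h1.add h2) hf,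
        integral_add h1 h2, integral_const_mul, integral_const_mul]
      ring
    rw [← this]
    exact integral_nonneg fun x => sq_nonneg _
  have := discrim_le_zero h
  rw [discrim] at this
  nlinarith

/-! ### The Gaussian law in eigencoordinates and its orthogonal images -/

/-- The centred Gaussian law on `ℝ^p` with independent coordinates of variances `v k`. -/
def coordLaw {p : ℕ} (v : Fin p → NNReal) : Measure (Fin p → ℝ) :=
  Measure.pi fun k => gaussianReal 0 (v k)

instance {p : ℕ} (v : Fin p → NNReal) : IsProbabilityMeasure (coordLaw v) :=
  inferInstanceAs (IsProbabilityMeasure (Measure.pi _))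

/-- The Lebesgue density of `coordLaw`. -/
def coordDensity {p : ℕ} (v : Fin p → NNReal) (y : Fin p → ℝ) : ℝ :=
  ∏ k, gaussianPDFReal 0 (v k) (y k)

theorem coordDensity_pos {p : ℕ} {v : Fin p → NNReal} (hv : ∀ k, v k ≠ 0) (y : Fin p → ℝ) :
    0 < coordDensity v y :=
  Finset.prod_pos fun k _ => gaussianPDFReal_pos _ _ _ (hv k)

@[fun_prop]
theorem measurable_coordDensity {p : ℕ} (v : Fin p → NNReal) : Measurable (coordDensity v) := by
  unfold coordDensity
  fun_prop

theorem coordLaw_eq_withDensity {p : ℕ} {v : Fin p → NNReal} (hv : ∀ k, v k ≠ 0) :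
    coordLaw v = volume.withDensity fun y => ENNReal.ofReal (coordDensity v y) := by
  have h : ∀ k, gaussianReal 0 (v k) =
      volume.withDensity fun x => ENNReal.ofReal (gaussianPDFReal 0 (v k) x) := fun k => by
    rw [gaussianReal_of_var_ne_zero _ (hv k)]; rfl
  have : ∀ k, SigmaFinite
      ((volume : Measure ℝ).withDensity fun x => ENNReal.ofReal (gaussianPDFReal 0 (v k) x)) :=
    fun k => by rw [← h k]; infer_instance
  unfold coordLaw coordDensity
  simp_rw [h]
  exact pi_withDensity_ofReal (fun _ => volume) (fun k x => gaussianPDFReal 0 (v k) x)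
    (fun k x => gaussianPDFReal_nonneg _ _ _) (fun k => integrable_gaussianPDFReal _ _)

theorem transpose_mul_self (p : ℕ) (g : OGroup p) : (g : Mat p).transpose * (g : Mat p) = 1 :=
  (Matrix.mem_orthogonalGroup_iff' (Fin p) ℝ).mp g.2

theorem self_mul_transpose (p : ℕ) (g : OGroup p) : (g : Mat p) * (g : Mat p).transpose = 1 :=
  (Matrix.mem_orthogonalGroup_iff (Fin p) ℝ).mp g.2

theorem map_orthogonal_volume {p : ℕ} (g : OGroup p) :
    (volume : Measure (Fin p → ℝ)).map (fun y => (g : Mat p).mulVec y) = volume := by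
  have hdet : (g : Mat p).det * (g : Mat p).det = 1 := by
    have := congrArg Matrix.det (self_mul_transpose p g)
    rwa [Matrix.det_mul, Matrix.det_transpose, Matrix.det_one] at this
  have h0 : (g : Mat p).det ≠ 0 := fun h => by simp [h] at hdet
  have := Real.map_matrix_volume_pi_eq_smul_volume_pi h0
  have habs : |((g : Mat p).det)⁻¹| = 1 := by
    rw [abs_inv, inv_eq_one]
    have : |(g : Mat p).det| * |(g : Mat p).det| = 1 := by rw [← abs_mul, hdet, abs_one]
    nlinarith [abs_nonneg (g : Mat p).det]
  rw [habs, ENNReal.ofReal_one, one_smul] at this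
  exact this

/-- Orthogonal maps preserve Lebesgue measure, so the image law has density f(gᵀy); dividing by the
positive density f(y) makes it a density relative to the original law. -/
theorem map_orthogonal_coordLaw {p : ℕ} {v : Fin p → NNReal} (hv : ∀ k, v k ≠ 0) (g : OGroup p) :
    (coordLaw v).map (fun y => (g : Mat p).mulVec y) =
      (coordLaw v).withDensity fun y => ENNReal.ofReal
        (coordDensity v ((g : Mat p).transpose.mulVec y) / coordDensity v y) := by
  have hm : Measurable fun y : Fin p → ℝ => (g : Mat p).mulVec y :=
    (Continuous.matrix_mulVec continuous_const continuous_id).measurable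
  have hmt : Measurable fun y : Fin p → ℝ => (g : Mat p).transpose.mulVec y :=
    (Continuous.matrix_mulVec continuous_const continuous_id).measurable
  have hd : Measurable fun y => ENNReal.ofReal (coordDensity v y) := by fun_prop
  ext s hs
  have e1 : (coordLaw v).withDensity (fun y => ENNReal.ofReal
        (coordDensity v ((g : Mat p).transpose.mulVec y) / coordDensity v y)) =
      volume.withDensity fun y => ENNReal.ofReal
        (coordDensity v ((g : Mat p).transpose.mulVec y)) := by
    rw [coordLaw_eq_withDensity hv, ← withDensity_mul _ hd (by fun_prop)]
    congr 1
    ext y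
    simp only [Pi.mul_apply]
    rw [← ENNReal.ofReal_mul (coordDensity_pos hv y).le, mul_div_cancel₀ _
      (coordDensity_pos hv y).ne']
  rw [e1, Measure.map_apply hm hs, coordLaw_eq_withDensity hv, withDensity_apply _ (hm hs),
    withDensity_apply _ hs]
  -- Lebesgue measure is replaced by its own image under g on one side only, so that the change of
  -- variables turns gᵀ(gy) into y.
  conv_rhs => rw [← map_orthogonal_volume g]
  rw [setLIntegral_map hs (by fun_prop) hm]
  simp [Matrix.mulVec_mulVec, transpose_mul_self]

/-! ### Planar rotations and their likelihood ratios -/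

/-- The matrix with block `(c, s; -s, c)` in the plane of the coordinates `i, j`. -/
def planarMat {p : ℕ} (i j : Fin p) (s c : ℝ) : Mat p :=
  Matrix.of fun k => if k = i then c • Pi.single i 1 + s • Pi.single j 1
    else if k = j then -s • Pi.single i 1 + c • Pi.single j 1 else Pi.single k 1

theorem planarMat_transpose {p : ℕ} {i j : Fin p} (hij : i ≠ j) (s c : ℝ) :
    (planarMat i j s c).transpose = planarMat i j (-s) c := by
  ext k l
  simp only [planarMat, Matrix.transpose_apply, Matrix.of_apply]
  by_cases hki : k = i <;> by_cases hkj : k = j <;> by_cases hli : l = i <;>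
    by_cases hlj : l = j <;> by_cases hkl : k = l <;>
    simp_all [eq_comm]

theorem planarMat_mulVec {p : ℕ} (i j : Fin p) (s c : ℝ) (y : Fin p → ℝ) (k : Fin p) :
    (planarMat i j s c).mulVec y k = if k = i then c * y i + s * y j
      else if k = j then -s * y i + c * y j else y k := by
  change (if k = i then c • Pi.single i 1 + s • Pi.single j 1
    else if k = j then -s • Pi.single i 1 + c • Pi.single j 1 else Pi.single k 1) ⬝ᵥ y = _
  split_ifs
  · rw [add_dotProduct, smul_dotProduct, smul_dotProduct]; simp
  · rw [add_dotProduct, smul_dotProduct, smul_dotProduct]; simp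
  · simp

theorem planarMat_mem {p : ℕ} {i j : Fin p} (hij : i ≠ j) {s c : ℝ} (h : c ^ 2 + s ^ 2 = 1) :
    planarMat i j s c ∈ Matrix.orthogonalGroup (Fin p) ℝ := by
  rw [Matrix.mem_orthogonalGroup_iff]
  change planarMat i j s c * (planarMat i j s c).transpose = 1
  rw [← Matrix.mulVec_injective.eq_iff]
  ext y k
  rw [planarMat_transpose hij, ← Matrix.mulVec_mulVec]
  simp only [planarMat_mulVec, Matrix.one_mulVec]
  by_cases h1 : k = i
  · subst h1
    simp only [hij.symm, if_true, if_false]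
    linear_combination y k * h
  · by_cases h2 : k = j
    · subst h2
      simp only [hij.symm, if_true, if_false]
      linear_combination y k * h
    · simp [h1, h2]

/-- Rotation in the plane of the coordinates `i, j`. -/
def planarRotation {p : ℕ} {i j : Fin p} (hij : i ≠ j) {s c : ℝ} (h : c ^ 2 + s ^ 2 = 1) :
    OGroup p :=
  ⟨planarMat i j s c, planarMat_mem hij h⟩

/-- The density of the rotated law with respect to `coordLaw v`. -/
def likelihoodRatio {p : ℕ} (v : Fin p → NNReal) (i j : Fin p) (s c : ℝ) (y : Fin p → ℝ) : ℝ :=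
  Real.exp (-((v i : ℝ)⁻¹ - (v j : ℝ)⁻¹) / 2 *
    (-s ^ 2 * y i ^ 2 - 2 * c * s * y i * y j + s ^ 2 * y j ^ 2))

/-- Only the coordinates i and j move, and y_i² + y_j² is preserved. The increments of the two
squares are therefore opposite, which leaves the factor 1/v_i - 1/v_j. -/
theorem coordDensity_div {p : ℕ} {v : Fin p → NNReal} (hv : ∀ k, v k ≠ 0) {i j : Fin p}
    (hij : i ≠ j) {s c : ℝ} (h : c ^ 2 + s ^ 2 = 1) (y : Fin p → ℝ) :
    coordDensity v ((planarMat i j s c).transpose.mulVec y) / coordDensity v y =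
      likelihoodRatio v i j s c y := by
  have hr : ∀ (k : Fin p) (a b : ℝ), gaussianPDFReal 0 (v k) a / gaussianPDFReal 0 (v k) b =
      Real.exp (-(a ^ 2 - b ^ 2) / (2 * v k)) := by
    intro k a b
    have h1 : √(2 * Real.pi * v k) ≠ 0 := by
      have : (0 : ℝ) < v k := by have := hv k; positivity
      positivity
    rw [gaussianPDFReal, gaussianPDFReal, mul_div_mul_left _ _ (inv_ne_zero h1), ← Real.exp_sub]
    congr 1
    ring
  rw [coordDensity, coordDensity, ← Finset.prod_div_distrib]
  simp_rw [hr]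
  rw [← Real.exp_sum, likelihoodRatio]
  congr 1
  rw [Finset.sum_eq_add i j hij]
  · rw [planarMat_transpose hij, planarMat_mulVec, planarMat_mulVec]
    simp only [hij.symm, if_true, if_false]
    have hi : (v i : ℝ) ≠ 0 := by exact_mod_cast hv i
    have hj : (v j : ℝ) ≠ 0 := by exact_mod_cast hv j
    field_simp
    have hc : c ^ 2 = 1 - s ^ 2 := by linarith
    ring_nf
    rw [hc]
    ring
  · intro k _ hk
    rw [planarMat_transpose hij, planarMat_mulVec, if_neg hk.1, if_neg hk.2]
    simp
  · simp
  · simp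

theorem map_planarRotation_coordLaw {p : ℕ} {v : Fin p → NNReal} (hv : ∀ k, v k ≠ 0) {i j : Fin p}
    (hij : i ≠ j) {s c : ℝ} (h : c ^ 2 + s ^ 2 = 1) :
    (coordLaw v).map (fun y => (planarMat i j s c).mulVec y) =
      (coordLaw v).withDensity fun y => ENNReal.ofReal (likelihoodRatio v i j s c y) := by
  have := map_orthogonal_coordLaw hv (planarRotation hij h)
  simp_rw [planarRotation, coordDensity_div hv hij h] at this
  exact this

/-- The likelihood ratio involves two coordinates only; this reduces its second moment to a double
integral. -/
theorem map_eval_pair_coordLaw {p : ℕ} (v : Fin p → NNReal) {i j : Fin p} (hij : i ≠ j) :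
    (coordLaw v).map (fun y => (y j, y i)) =
      (gaussianReal 0 (v j)).prod (gaussianReal 0 (v i)) := by
  have hind : iIndepFun (fun k (y : Fin p → ℝ) => id (y k)) (coordLaw v) :=
    iIndepFun_pi fun _ => aemeasurable_id
  have h2 := (hind.indepFun hij.symm)
  simp only [id] at h2
  rw [indepFun_iff_map_prod_eq_prod_map_map (measurable_pi_apply j).aemeasurable
    (measurable_pi_apply i).aemeasurable] at h2
  rw [h2]
  congr 1
  · exact (measurePreserving_eval (fun k => gaussianReal 0 (v k)) j).map_eq
  · exact (measurePreserving_eval (fun k => gaussianReal 0 (v k)) i).map_eq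

theorem likelihoodRatio_pos {p : ℕ} (v : Fin p → NNReal) (i j : Fin p) (s c : ℝ)
    (y : Fin p → ℝ) : 0 < likelihoodRatio v i j s c y := Real.exp_pos _

@[fun_prop]
theorem measurable_likelihoodRatio {p : ℕ} (v : Fin p → NNReal) (i j : Fin p) (s c : ℝ) :
    Measurable (likelihoodRatio v i j s c) := by
  unfold likelihoodRatio
  fun_prop

/-- The `χ²`-integral of a planar rotation. -/
theorem integral_likelihoodRatio_sq {p : ℕ} {v : Fin p → NNReal} (hv : ∀ k, v k ≠ 0)
    {i j : Fin p} (hji : v j < v i) {s c : ℝ} (h : c ^ 2 + s ^ 2 = 1)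
    (hs : 2 * (((v i : ℝ) - v j) ^ 2 / (v i * v j)) * s ^ 2 < 1) :
    ∫ y, likelihoodRatio v i j s c y ^ 2 ∂(coordLaw v) =
      (√(1 - 2 * (((v i : ℝ) - v j) ^ 2 / (v i * v j)) * s ^ 2))⁻¹ := by
  have hij : i ≠ j := by rintro rfl; exact lt_irrefl _ hji
  have hi : (0 : ℝ) < v i := by have := hv i; positivity
  have hj : (0 : ℝ) < v j := by have := hv j; positivity
  have hlt : (v j : ℝ) < v i := by exact_mod_cast hji
  set κ : ℝ := ((v i : ℝ) - v j) ^ 2 / (v i * v j) with hκ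
  set δ : ℝ := (v i : ℝ)⁻¹ - (v j : ℝ)⁻¹ with hδ
  have hδneg : δ < 0 := sub_neg.mpr (inv_strictAnti₀ hj hlt)
  set A : ℝ := δ * s ^ 2 with hA
  have hA0 : A ≤ 0 := mul_nonpos_of_nonpos_of_nonneg hδneg.le (sq_nonneg s)
  set D : ℝ := 1 - 2 * v i * A with hD
  have hD1 : 0 < D := by
    have : v i * A ≤ 0 := mul_nonpos_of_nonneg_of_nonpos hi.le hA0
    rw [hD]; nlinarith
  -- The coefficient of y_j² that remains in the exponent after y_i has been integrated out.
  set A' : ℝ := v i * (2 * δ * c * s) ^ 2 / (2 * D) - A with hA'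
  -- The product of the two successive normalizing factors is the determinant of the 2 × 2 Gaussian
  -- integral. As D > 0, positivity of the right-hand side forces positivity of the second factor.
  have hprod : D * (1 - 2 * v j * A') = 1 - 2 * κ * s ^ 2 := by
    have : D * (1 - 2 * v j * A') =
        D + 2 * v j * A * D - v j * v i * (2 * δ * c * s) ^ 2 := by
      rw [hA']; field_simp; ring
    rw [this, mul_pow, mul_pow, show c ^ 2 = 1 - s ^ 2 by linarith, hD, hA, hδ, hκ]
    field_simp
    ring
  have hD2 : 0 < 1 - 2 * v j * A' := by
    by_contra hcon
    have := mul_nonpos_of_nonneg_of_nonpos hD1.le (not_lt.mp hcon)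
    linarith
  let F : ℝ × ℝ → ℝ := fun z => Real.exp (-A * z.1 ^ 2) *
    Real.exp (A * z.2 ^ 2 + (2 * δ * c * s * z.1) * z.2)
  have hF : ∀ y : Fin p → ℝ, likelihoodRatio v i j s c y ^ 2 = F (y j, y i) := by
    intro y
    simp only [F]
    rw [likelihoodRatio, ← Real.exp_nat_mul, ← Real.exp_add]
    congr 1
    push_cast
    rw [hA]
    ring
  have hFm : Measurable F := by fun_prop
  have hin : ∀ a : ℝ, ∫ x, F (a, x) ∂(gaussianReal 0 (v i)) =
      (√D)⁻¹ * Real.exp (A' * a ^ 2 + 0 * a) := by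
    intro a
    simp only [F]
    rw [integral_const_mul, integral_exp_quadratic_gaussianReal (hv i) _ (by linarith), ← hD,
      mul_left_comm, ← Real.exp_add]
    congr 2
    rw [hA']
    field_simp
    ring
  have hout := integral_exp_quadratic_gaussianReal (hv j) (A := A') 0 (by linarith)
  have hFint : Integrable F ((gaussianReal 0 (v j)).prod (gaussianReal 0 (v i))) := by
    rw [integrable_prod_iff hFm.aestronglyMeasurable]
    constructor
    -- A Bochner integral with a nonzero value can only come from an integrable function, so the
    -- explicit value also proves integrability.
    · refine ae_of_all _ fun a => Integrable.of_integral_ne_zero ?_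
      rw [hin]
      positivity
    · have hn : ∀ z, ‖F z‖ = F z := fun z => Real.norm_of_nonneg (by positivity)
      simp_rw [hn, hin]
      refine Integrable.const_mul (Integrable.of_integral_ne_zero ?_) _
      rw [hout]
      positivity
  calc ∫ y, likelihoodRatio v i j s c y ^ 2 ∂(coordLaw v)
      = ∫ z, F z ∂((coordLaw v).map fun y => (y j, y i)) := by
        rw [integral_map (by fun_prop) hFm.aestronglyMeasurable]
        exact integral_congr_ae (ae_of_all _ hF)
    _ = _ := by
        rw [map_eval_pair_coordLaw v hij, integral_prod _ hFint]
        simp_rw [hin]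
        rw [integral_const_mul, hout, ← hprod, Real.sqrt_mul hD1.le, mul_inv]
        simp

/-! ### From Chapman–Robbins to Cramér–Rao for equivariant functions -/

/-- The law of `n` independent observations with independent Gaussian coordinates. -/
def coordSampleLaw {p : ℕ} (n : ℕ) (v : Fin p → NNReal) : Measure (Fin n → Fin p → ℝ) :=
  Measure.pi fun _ => coordLaw v

instance {p : ℕ} (n : ℕ) (v : Fin p → NNReal) : IsProbabilityMeasure (coordSampleLaw n v) :=
  inferInstanceAs (IsProbabilityMeasure (Measure.pi _))

theorem integral_comp_planarRotation {p n : ℕ} {v : Fin p → NNReal} (hv : ∀ k, v k ≠ 0)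
    {i j : Fin p} (hij : i ≠ j) {s c : ℝ} (h : c ^ 2 + s ^ 2 = 1)
    {f : (Fin n → Fin p → ℝ) → ℝ} (hf : Measurable f) :
    ∫ y, f (fun k => (planarMat i j s c).mulVec (y k)) ∂(coordSampleLaw n v) =
      ∫ y, (∏ k, likelihoodRatio v i j s c (y k)) * f y ∂(coordSampleLaw n v) := by
  have hm : Measurable fun y : Fin p → ℝ => (planarMat i j s c).mulVec y :=
    (Continuous.matrix_mulVec continuous_const continuous_id).measurable
  have hmap := map_planarRotation_coordLaw hv hij h
  have hprob : IsProbabilityMeasure ((coordLaw v).withDensity fun y =>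
      ENNReal.ofReal (likelihoodRatio v i j s c y)) := by
    rw [← hmap]; exact Measure.isProbabilityMeasure_map hm.aemeasurable
  -- The ratio is the density of a probability measure, so its lower integral is 1, hence finite.
  have hint : Integrable (likelihoodRatio v i j s c) (coordLaw v) := by
    rw [← lintegral_ofReal_ne_top_iff_integrable (by fun_prop)
      (ae_of_all _ fun y => (likelihoodRatio_pos v i j s c y).le)]
    have h1 := hprob.measure_univ
    rw [withDensity_apply _ MeasurableSet.univ, Measure.restrict_univ] at h1
    rw [h1]
    exact ENNReal.one_ne_top
  have hpi : (coordSampleLaw n v).map (fun y k => (planarMat i j s c).mulVec (y k)) =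
      (coordSampleLaw n v).withDensity fun y =>
        ENNReal.ofReal (∏ k, likelihoodRatio v i j s c (y k)) := by
    unfold coordSampleLaw
    rw [Measure.pi_map_pi fun _ => hm.aemeasurable, hmap]
    exact pi_withDensity_ofReal (fun _ => coordLaw v) (fun _ => likelihoodRatio v i j s c)
      (fun _ x => (likelihoodRatio_pos v i j s c x).le) fun _ => hint
  have hmm : Measurable fun (y : Fin n → Fin p → ℝ) k => (planarMat i j s c).mulVec (y k) :=
    measurable_pi_lambda _ fun k => hm.comp (measurable_pi_apply k)
  rw [← integral_map hmm.aemeasurable hf.aestronglyMeasurable, hpi,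
    integral_withDensity_eq_integral_toReal_smul (by fun_prop) (by simp)]
  refine integral_congr_ae (ae_of_all _ fun y => ?_)
  simp only [smul_eq_mul]
  rw [ENNReal.toReal_ofReal (Finset.prod_nonneg fun k _ => (likelihoodRatio_pos v i j s c _).le)]

theorem integrable_of_abs_le {α : Type*} [MeasurableSpace α] {μ : Measure α} [IsFiniteMeasure μ]
    {f : α → ℝ} (hf : Measurable f) (C : ℝ) (h : ∀ x, |f x| ≤ C) : Integrable f μ :=
  Integrable.of_bound hf.aestronglyMeasurable C (ae_of_all _ h)

theorem planarMat_conj_apply {p : ℕ} {i j : Fin p} (hij : i ≠ j) (s c : ℝ) (m : Mat p) :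
    (planarMat i j s c * m * (planarMat i j s c).transpose) i j =
      c * s * (m j j - m i i) + c ^ 2 * m i j - s ^ 2 * m j i := by
  have h1 : ∀ l, (planarMat i j s c * m) i l = c * m i l + s * m j l := by
    intro l
    have := planarMat_mulVec i j s c (fun k => m k l) i
    rw [if_pos rfl] at this
    exact this
  have h2 := planarMat_mulVec i j s c ((planarMat i j s c * m) i) j
  rw [if_neg hij.symm, if_pos rfl] at h2
  calc _ = (planarMat i j s c).mulVec ((planarMat i j s c * m) i) j := by
        rw [Matrix.mul_apply, Matrix.mulVec, dotProduct]
        exact Finset.sum_congr rfl fun k _ => mul_comm _ _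
    _ = _ := by rw [h2, h1, h1]; ring

/-- The Chapman–Robbins inequality for one planar rotation of an equivariant function. -/
theorem sq_integral_le_planarRotation {p n : ℕ} {v : Fin p → NNReal} (hv : ∀ k, v k ≠ 0)
    {i j : Fin p} (hji : v j < v i) {m : (Fin n → Fin p → ℝ) → Mat p}
    (hm : ∀ k l, Measurable fun y => m y k l) (hb : ∀ y k l, |m y k l| ≤ 1)
    (hequiv : ∀ (g : OGroup p) (y), m (fun k => (g : Mat p).mulVec (y k)) =
      (g : Mat p) * m y * (g : Mat p).transpose)
    {s c : ℝ} (h : c ^ 2 + s ^ 2 = 1)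
    (hs : 2 * (((v i : ℝ) - v j) ^ 2 / (v i * v j)) * s ^ 2 < 1) :
    (c * s * (∫ y, (m y j j - m y i i) ∂(coordSampleLaw n v)) -
        s ^ 2 * ∫ y, (m y i j + m y j i) ∂(coordSampleLaw n v)) ^ 2 ≤
      (∫ y, m y i j ^ 2 ∂(coordSampleLaw n v)) *
        ((√(1 - 2 * (((v i : ℝ) - v j) ^ 2 / (v i * v j)) * s ^ 2))⁻¹ ^ n - 1) := by
  have hij : i ≠ j := by rintro rfl; exact lt_irrefl _ hji
  set ν := coordSampleLaw n v with hν
  set L : (Fin n → Fin p → ℝ) → ℝ := fun y => ∏ k, likelihoodRatio v i j s c (y k) with hL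
  have hLm : Measurable L := by fun_prop
  have hint : ∀ k l, Integrable (fun y => m y k l) ν := fun k l =>
    integrable_of_abs_le (hm k l) 1 fun y => hb y k l
  have hLsq : ∫ y, L y ^ 2 ∂ν =
      (√(1 - 2 * (((v i : ℝ) - v j) ^ 2 / (v i * v j)) * s ^ 2))⁻¹ ^ n := by
    simp_rw [hL, ← Finset.prod_pow]
    rw [hν, coordSampleLaw, integral_fintype_prod_eq_pow (fun x => likelihoodRatio v i j s c x ^ 2),
      integral_likelihoodRatio_sq hv hji h hs, Fintype.card_fin]
  have hLsqint : Integrable (fun y => L y ^ 2) ν := by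
    refine Integrable.of_integral_ne_zero ?_
    rw [hLsq]
    have : 0 < √(1 - 2 * (((v i : ℝ) - v j) ^ 2 / (v i * v j)) * s ^ 2) :=
      Real.sqrt_pos.mpr (by linarith)
    positivity
  have hL2 : MemLp L 2 ν := (memLp_two_iff_integrable_sq hLm.aestronglyMeasurable).mpr hLsqint
  have hLint : Integrable L ν := hL2.integrable (by norm_num)
  have hLone : ∫ y, L y ∂ν = 1 := by
    have := integral_comp_planarRotation (n := n) hv hij h (f := fun _ => 1) measurable_const
    simpa using this.symm
  have hmL : Integrable (fun y => L y * m y i j) ν :=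
    hLint.mul_bdd (c := 1) (hm i j).aestronglyMeasurable (ae_of_all _ fun y => hb y i j)
  have hrot := integral_comp_planarRotation (n := n) hv hij h (hm i j)
  -- Writing c² = 1 - s² isolates m_ij itself: the rotation changes this entry by the diagonal
  -- difference at first order in s, and by a remainder of order s².
  have heq : ∀ y : Fin n → Fin p → ℝ, m (fun k => (planarMat i j s c).mulVec (y k)) i j =
      c * s * (m y j j - m y i i) - s ^ 2 * (m y i j + m y j i) + m y i j := by
    intro y
    have h0 := congrFun (congrFun (hequiv (planarRotation hij h) y) i) j
    have := planarMat_conj_apply hij s c (m y)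
    rw [show c ^ 2 = 1 - s ^ 2 by linarith] at this
    exact h0.trans (this.trans (by ring))
  simp_rw [heq] at hrot
  have i1 : Integrable (fun y => c * s * (m y j j - m y i i)) ν :=
    ((hint j j).sub (hint i i)).const_mul _
  have i2 : Integrable (fun y => s ^ 2 * (m y i j + m y j i)) ν :=
    ((hint i j).add (hint j i)).const_mul _
  rw [integral_add (f := fun y => c * s * (m y j j - m y i i) - s ^ 2 * (m y i j + m y j i))
    (i1.sub i2) (hint i j), integral_sub i1 i2, integral_const_mul, integral_const_mul] at hrot
  -- The mean change of m_ij under the rotation, written as its pairing with L - 1. Cauchy–Schwarz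
  -- then separates 𝔼 m_ij² from the χ² divergence 𝔼(L - 1)².
  have hfin : ∫ y, m y i j * (L y - 1) ∂ν =
      c * s * (∫ y, (m y j j - m y i i) ∂ν) - s ^ 2 * ∫ y, (m y i j + m y j i) ∂ν := by
    have e : ∀ y, m y i j * (L y - 1) = L y * m y i j - m y i j := fun y => by ring
    simp_rw [e]
    rw [integral_sub hmL (hint i j)]
    linarith
  have hL1 : ∫ y, (L y - 1) ^ 2 ∂ν = (∫ y, L y ^ 2 ∂ν) - 1 := by
    have e : ∀ y, (L y - 1) ^ 2 = L y ^ 2 - (2 * L y - 1) := fun y => by ring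
    simp_rw [e]
    rw [integral_sub (g := fun y => 2 * L y - 1) hLsqint
      ((hLint.const_mul 2).sub (integrable_const 1)), integral_sub (hLint.const_mul 2) (integrable_const 1), integral_const_mul, hLone]
    simp
    norm_num
  rw [← hfin, ← hLsq, ← hL1]
  refine sq_integral_mul_le ?_ ?_ ?_
  · refine integrable_of_abs_le ((hm i j).pow_const 2) 1 fun y => ?_
    rw [abs_pow]
    exact pow_le_one₀ (abs_nonneg _) (hb y i j)
  · exact (memLp_two_iff_integrable_sq (hLm.sub_const 1).aestronglyMeasurable).mp
      (hL2.sub (memLp_const 1))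
  · have := hmL.sub (hint i j)
    refine this.congr (ae_of_all _ fun y => ?_)
    simp only [Pi.sub_apply]
    ring

/-- The Cramér–Rao type inequality for equivariant functions: the limit of the Chapman–Robbins
inequality for rotations by small angles. -/
theorem information_inequality {p n : ℕ} {v : Fin p → NNReal} (hv : ∀ k, v k ≠ 0)
    {i j : Fin p} (hji : v j < v i) {m : (Fin n → Fin p → ℝ) → Mat p}
    (hm : ∀ k l, Measurable fun y => m y k l) (hb : ∀ y k l, |m y k l| ≤ 1)
    (hequiv : ∀ (g : OGroup p) (y), m (fun k => (g : Mat p).mulVec (y k)) =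
      (g : Mat p) * m y * (g : Mat p).transpose) :
    (∫ y, (m y i i - m y j j) ∂(coordSampleLaw n v)) ^ 2 ≤
      n * (((v i : ℝ) - v j) ^ 2 / (v i * v j)) * ∫ y, m y i j ^ 2 ∂(coordSampleLaw n v) := by
  set κ : ℝ := ((v i : ℝ) - v j) ^ 2 / (v i * v j) with hκ
  set D := ∫ y, (m y j j - m y i i) ∂(coordSampleLaw n v)
  set E := ∫ y, (m y i j + m y j i) ∂(coordSampleLaw n v)
  set V := ∫ y, m y i j ^ 2 ∂(coordSampleLaw n v)
  have hD : ∫ y, (m y i i - m y j j) ∂(coordSampleLaw n v) = -D := by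
    rw [← integral_neg]
    simp
  rw [hD, neg_sq]
  -- The parameter is w = s², the scale on which the divergence is linear: φ(w) = (1 - 2κw)^(-n/2)
  -- has derivative nκ at 0.
  let φ : ℝ → ℝ := fun w => (√(1 - 2 * κ * w))⁻¹ ^ n
  have hφ : HasDerivAt φ (n * κ) 0 := by
    have h1 : HasDerivAt (fun w : ℝ => 1 - 2 * κ * w) (-(2 * κ)) 0 := by
      simpa using ((hasDerivAt_id (0 : ℝ)).const_mul (2 * κ)).const_sub 1
    have h2 := (h1.sqrt (by simp)).inv (by simp)
    have h3 := h2.pow n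
    refine h3.congr_deriv ?_
    simp
    ring
  have hslope := hφ.tendsto_slope_zero_right
  have hR : Filter.Tendsto (fun w => V * (w⁻¹ • (φ (0 + w) - φ 0))) (nhdsWithin 0 (Set.Ioi 0))
      (nhds (n * κ * V)) := by
    rw [mul_comm _ V]
    exact hslope.const_mul V
  have hLt : Filter.Tendsto (fun w : ℝ => (√(1 - w) * D - √w * E) ^ 2)
      (nhdsWithin 0 (Set.Ioi 0)) (nhds (D ^ 2)) := by
    have : Continuous fun w : ℝ => (√(1 - w) * D - √w * E) ^ 2 := by fun_prop
    have := (this.tendsto 0).mono_left (nhdsWithin_le_nhds (s := Set.Ioi (0 : ℝ)))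
    simpa using this
  refine le_of_tendsto_of_tendsto hLt hR ?_
  have hev1 : ∀ᶠ w in nhds (0 : ℝ), 2 * κ * w < 1 ∧ w < 1 := by
    have c1 : Continuous fun w : ℝ => 2 * κ * w := by fun_prop
    exact (c1.tendsto 0 |>.eventually_lt_const (by simp)).and
      (eventually_lt_nhds one_pos)
  filter_upwards [nhdsWithin_le_nhds hev1, self_mem_nhdsWithin] with w hw hw0
  have hw0 : 0 < w := hw0
  have hsw : √w ^ 2 = w := Real.sq_sqrt hw0.le
  have hcw : √(1 - w) ^ 2 = 1 - w := Real.sq_sqrt (by linarith [hw.2])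
  have main := sq_integral_le_planarRotation (n := n) hv hji hm hb hequiv (s := √w) (c := √(1 - w))
    (by rw [hsw, hcw]; ring) (by rw [hsw]; exact hw.1)
  rw [hsw] at main
  -- The left side carries a factor w. Dividing by it turns the right side into V times a difference
  -- quotient of φ and makes the E term vanish in the limit.
  have e1 : (√(1 - w) * √w * D - w * E) ^ 2 = w * (√(1 - w) * D - √w * E) ^ 2 := by
    have : √(1 - w) * √w * D - w * E = √w * (√(1 - w) * D - √w * E) := by
      linear_combination E * hsw
    rw [this, mul_pow, hsw]
  have main' : w * (√(1 - w) * D - √w * E) ^ 2 ≤ V * (φ w - 1) := by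
    rw [← e1]; exact main
  have hφ0 : φ 0 = 1 := by simp [φ]
  rw [zero_add, hφ0, smul_eq_mul, mul_left_comm, ← div_eq_inv_mul, le_div_iff₀ hw0, mul_comm]
  exact main'

/-! ### Samples as rotated eigencoordinates -/

/-- The eigenvalues as variances. -/
def eigVar (p : ℕ) (lam : ℕ → ℝ) (k : Fin p) : NNReal := (lam (k.val + 1)).toNNReal

/-- The observation vector with coordinates `y` in the basis of the columns of `U`. -/
def observe {p : ℕ} (U : OGroup p) (y : Fin p → ℝ) : Vec p :=
  WithLp.toLp 2 ((U : Mat p).mulVec y)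

theorem measurable_observe {p : ℕ} (U : OGroup p) : Measurable (observe U) := by
  have : Measurable fun y : Fin p → ℝ => (U : Mat p).mulVec y :=
    (Continuous.matrix_mulVec continuous_const continuous_id).measurable
  exact (MeasurableEquiv.toLp 2 (Fin p → ℝ)).measurable.comp this

theorem covMat_posSemidef {p : ℕ} {lam : ℕ → ℝ} (hpos : ∀ k : Fin p, 0 < lam (k.val + 1))
    (U : OGroup p) : (covMat lam U).PosSemidef := by
  have h : (Matrix.diagonal (fun k : Fin p => lam (k.val + 1))).PosSemidef :=
    Matrix.PosSemidef.diagonal fun k => (hpos k).le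
  have := h.mul_mul_conjTranspose_same (U : Mat p)
  rwa [Matrix.conjTranspose_eq_transpose_of_trivial] at this

/-- Both characteristic functions at t equal exp(-½ ∑ λ_k (Uᵀt)_k²). This moves the dependence on U
from the law to the map. -/
theorem gaussianLaw_eq_map {p : ℕ} {lam : ℕ → ℝ} (hpos : ∀ k : Fin p, 0 < lam (k.val + 1))
    (U : OGroup p) : gaussianLaw lam U = (coordLaw (eigVar p lam)).map (observe U) := by
  have hprob : IsProbabilityMeasure ((coordLaw (eigVar p lam)).map (observe U)) :=
    Measure.isProbabilityMeasure_map (measurable_observe U).aemeasurable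
  unfold gaussianLaw
  apply Measure.ext_of_charFun
  ext t
  have hinner : ∀ y : Fin p → ℝ, inner ℝ (observe U y) t =
      inner ℝ (WithLp.toLp 2 y : Vec p) (WithLp.toLp 2 ((U : Mat p).transpose.mulVec t)) := by
    intro y
    simp only [EuclideanSpace.inner_eq_star_dotProduct, observe, star_trivial]
    rw [Matrix.mulVec_transpose, ← Matrix.dotProduct_mulVec]
  have h1 : charFun ((coordLaw (eigVar p lam)).map (observe U)) t =
      charFun ((coordLaw (eigVar p lam)).map (WithLp.toLp 2 : (Fin p → ℝ) → Vec p))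
        (WithLp.toLp 2 ((U : Mat p).transpose.mulVec t)) := by
    rw [charFun_apply, charFun_apply, integral_map (measurable_observe U).aemeasurable
      (by fun_prop), integral_map (by fun_prop) (by fun_prop)]
    simp_rw [hinner]
  rw [h1, coordLaw, charFun_pi, charFun_multivariateGaussian (covMat_posSemidef hpos U)]
  simp_rw [charFun_gaussianReal]
  rw [← Complex.exp_sum]
  congr 1
  have hq : t.ofLp ⬝ᵥ (covMat lam U).mulVec t.ofLp =
      ∑ k : Fin p, lam (k.val + 1) * ((U : Mat p).transpose.mulVec t) k ^ 2 := by
    rw [covMat, ← Matrix.mulVec_mulVec, ← Matrix.mulVec_mulVec, Matrix.dotProduct_mulVec,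
      ← Matrix.mulVec_transpose, dotProduct]
    refine Finset.sum_congr rfl fun k _ => ?_
    rw [Matrix.mulVec_diagonal]
    ring
  rw [hq]
  push_cast
  rw [inner_zero_right, Finset.sum_div, Complex.ofReal_zero, zero_mul, zero_sub,
    ← Finset.sum_neg_distrib]
  refine Finset.sum_congr rfl fun k _ => ?_
  rw [eigVar, Real.coe_toNNReal _ (hpos k).le]
  simp

theorem sampleLaw_eq_map {p n : ℕ} {lam : ℕ → ℝ} (hpos : ∀ k : Fin p, 0 < lam (k.val + 1))
    (U : OGroup p) : sampleLaw n lam U =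
      (coordSampleLaw n (eigVar p lam)).map fun y k => observe U (y k) := by
  have hprob : IsProbabilityMeasure ((coordLaw (eigVar p lam)).map (observe U)) :=
    Measure.isProbabilityMeasure_map (measurable_observe U).aemeasurable
  unfold sampleLaw coordSampleLaw
  rw [Measure.pi_map_pi fun _ => (measurable_observe U).aemeasurable, gaussianLaw_eq_map hpos]

/-! ### Entries, trace and conjugates of projections -/

section Projections

variable {p d : ℕ} {Q : Mat p}

theorem projections_transpose (hQ : Q ∈ projections p d) : Q.transpose = Q :=
  hQ.1.isSelfAdjoint

theorem projections_sq (hQ : Q ∈ projections p d) : Q * Q = Q :=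
  hQ.1.isIdempotentElem

theorem mem_projections_of {Q : Mat p} (h1 : Q.transpose = Q) (h2 : Q * Q = Q)
    (h3 : Q.rank = d) : Q ∈ projections p d :=
  ⟨⟨h2, h1⟩, h3⟩

/-- The diagonal of Q Qᵀ = Q; this is the source of every bound on entries used below. -/
theorem projections_row_sq (hQ : Q ∈ projections p d) (k : Fin p) : ∑ l, Q k l ^ 2 = Q k k := by
  have h := congrFun (congrFun (projections_sq hQ) k) k
  rw [Matrix.mul_apply] at h
  rw [← h]
  refine Finset.sum_congr rfl fun l _ => ?_
  have : Q l k = Q k l := congrFun (congrFun (projections_transpose hQ) k) l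
  rw [this, sq]

theorem projections_symm (hQ : Q ∈ projections p d) (k l : Fin p) : Q l k = Q k l :=
  congrFun (congrFun (projections_transpose hQ) k) l

theorem projections_diag_nonneg (hQ : Q ∈ projections p d) (k : Fin p) : 0 ≤ Q k k := by
  rw [← projections_row_sq hQ k]
  exact Finset.sum_nonneg fun l _ => sq_nonneg _

theorem projections_diag_le_one (hQ : Q ∈ projections p d) (k : Fin p) : Q k k ≤ 1 := by
  have h1 : Q k k ^ 2 ≤ Q k k := by
    conv_rhs => rw [← projections_row_sq hQ k]
    exact Finset.single_le_sum (f := fun l => Q k l ^ 2) (fun l _ => sq_nonneg _)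
      (Finset.mem_univ k)
  nlinarith

theorem projections_abs_le_one (hQ : Q ∈ projections p d) (k l : Fin p) : |Q k l| ≤ 1 := by
  have h1 : Q k l ^ 2 ≤ Q k k := by
    rw [← projections_row_sq hQ k]
    exact Finset.single_le_sum (f := fun l => Q k l ^ 2) (fun l _ => sq_nonneg _)
      (Finset.mem_univ l)
  exact (sq_le_one_iff_abs_le_one _).mp (h1.trans (projections_diag_le_one hQ k))

theorem projections_trace (hQ : Q ∈ projections p d) : Q.trace = d := by
  have hid : IsIdempotentElem (Matrix.toLin' Q) := by
    rw [IsIdempotentElem, Module.End.mul_eq_comp, ← Matrix.toLin'_mul, projections_sq hQ]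
  have := (LinearMap.isProj_range_iff_isIdempotentElem _).mpr hid
  have h2 := this.trace
  rw [Matrix.trace_toLin'_eq] at h2
  rw [h2, ← hQ.2]
  rfl

theorem conj_mem_projections (U : OGroup p) (hQ : Q ∈ projections p d) :
    (U : Mat p).transpose * Q * (U : Mat p) ∈ projections p d := by
  refine mem_projections_of ?_ ?_ ?_
  · simp only [Matrix.transpose_mul, Matrix.transpose_transpose, projections_transpose hQ,
      Matrix.mul_assoc]
  · calc (U : Mat p).transpose * Q * (U : Mat p) * ((U : Mat p).transpose * Q * (U : Mat p))
        = (U : Mat p).transpose * Q * ((U : Mat p) * (U : Mat p).transpose) * Q * (U : Mat p) := by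
          simp only [Matrix.mul_assoc]
      _ = _ := by
          rw [self_mul_transpose, Matrix.mul_one, Matrix.mul_assoc _ Q Q, projections_sq hQ]
  · have hu : IsUnit (U : Mat p).det :=
      (Matrix.isUnit_iff_isUnit_det _).mp (IsUnit.of_mul_eq_one _ (self_mul_transpose p U))
    have hu' : IsUnit (U : Mat p).transpose.det := by rwa [Matrix.det_transpose]
    rw [Matrix.rank_mul_eq_left_of_isUnit_det _ _ hu, Matrix.rank_mul_eq_right_of_isUnit_det _ _ hu',
      hQ.2]

end Projections

/-! ### The reconstruction error as a trace -/

theorem integral_eval_mul_eval_gaussianLaw {p : ℕ} {lam : ℕ → ℝ}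
    (hpos : ∀ k : Fin p, 0 < lam (k.val + 1)) (U : OGroup p) (k l : Fin p) :
    Integrable (fun x : Vec p => x k * x l) (gaussianLaw lam U) ∧
      ∫ x, x k * x l ∂(gaussianLaw lam U) = covMat lam U k l := by
  have hS := covMat_posSemidef hpos U
  have hmem : ∀ k, MemLp (fun x : Vec p => x k) 2 (gaussianLaw lam U) := fun k => by
    have := measurePreserving_eval_multivariateGaussian (μ := 0) hS (i := k)
    exact (memLp_id_gaussianReal (μ := (0 : Vec p) k) 2).comp_measurePreserving this
  have hmean : ∀ k, ∫ x, x k ∂(gaussianLaw lam U) = 0 := fun k => by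
    have := measurePreserving_eval_multivariateGaussian (μ := 0) hS (i := k)
    have h2 := integral_id_gaussianReal (μ := (0 : Vec p) k) (v := (covMat lam U k k).toNNReal)
    rw [← this.map_eq, integral_map this.measurable.aemeasurable (by fun_prop)] at h2
    exact h2
  have hprob : IsProbabilityMeasure (gaussianLaw lam U) := by
    unfold gaussianLaw; infer_instance
  refine ⟨(hmem k).integrable_mul (hmem l), ?_⟩
  have := covariance_eval_multivariateGaussian (μ := 0) hS k l
  rw [← this]
  have h3 := covariance_eq_sub (hmem k) (hmem l)
  rw [hmean, zero_mul, sub_zero] at h3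
  exact h3.symm

/-- Since 1 - P is an orthogonal projection, ‖x - Px‖² = xᵀ(1 - P)x. Its mean is tr((1 - P)UΛUᵀ),
and cyclicity moves U onto P. -/
theorem reconstructionError_eq {p d : ℕ} {lam : ℕ → ℝ} (hpos : ∀ k : Fin p, 0 < lam (k.val + 1))
    (U : OGroup p) {P : Mat p} (hP : P ∈ projections p d) :
    reconstructionError lam U P =
      ∑ k : Fin p, lam (k.val + 1) * (1 - ((U : Mat p).transpose * P * (U : Mat p)) k k) := by
  obtain ⟨a, ha⟩ : ∃ a : Fin p → Fin p → ℝ, ∀ k l, (1 - P : Mat p) k l = a k l :=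
    ⟨fun k l => (1 - P : Mat p) k l, fun _ _ => rfl⟩
  have hnorm : ∀ x : Vec p, ‖x - Matrix.toEuclideanLin P x‖ ^ 2 =
      ∑ k, ∑ l, a k l * (x k * x l) := by
    intro x
    have e : x - Matrix.toEuclideanLin P x = WithLp.toLp 2 ((1 - P).mulVec x) := by
      ext k
      simp [Matrix.sub_mulVec, Matrix.toEuclideanLin]
    have hsym : (1 - P).transpose = 1 - P := by
      rw [Matrix.transpose_sub, Matrix.transpose_one, projections_transpose hP]
    have hid : (1 - P) * (1 - P) = 1 - P := by
      rw [sub_mul, mul_sub, mul_sub, projections_sq hP]; simp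
    have : ‖(WithLp.toLp 2 ((1 - P).mulVec x) : Vec p)‖ ^ 2 = x.ofLp ⬝ᵥ (1 - P).mulVec x.ofLp := by
      rw [EuclideanSpace.real_norm_sq_eq]
      calc _ = ((1 - P).mulVec x) ⬝ᵥ ((1 - P).mulVec x) := by
            rw [dotProduct]; exact Finset.sum_congr rfl fun k _ => sq _
        _ = _ := by
            rw [Matrix.dotProduct_mulVec, ← Matrix.mulVec_transpose, hsym, Matrix.mulVec_mulVec,
              hid, dotProduct_comm]
    rw [e, this, dotProduct]
    refine Finset.sum_congr rfl fun k _ => ?_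
    rw [Matrix.mulVec, dotProduct, Finset.mul_sum]
    exact Finset.sum_congr rfl fun l _ => by rw [ha]; ring
  have hx := integral_eval_mul_eval_gaussianLaw hpos U
  rw [reconstructionError]
  simp_rw [hnorm]
  rw [integral_finsetSum _ fun k _ => integrable_finsetSum _ fun l _ => (hx k l).1.const_mul _]
  simp_rw [integral_finsetSum _ fun l _ => (hx _ l).1.const_mul _, integral_const_mul, (hx _ _).2]
  have hcsym : (covMat lam U).transpose = covMat lam U := (covMat_posSemidef hpos U).1
  have htr : ∑ k, ∑ l, a k l * covMat lam U k l = ((1 - P) * covMat lam U).trace := by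
    rw [Matrix.trace]
    refine Finset.sum_congr rfl fun k _ => ?_
    rw [Matrix.diag_apply, Matrix.mul_apply]
    refine Finset.sum_congr rfl fun l _ => ?_
    rw [show covMat lam U l k = covMat lam U k l from congrFun (congrFun hcsym k) l, ha]
  rw [htr, covMat, ← Matrix.mul_assoc, ← Matrix.mul_assoc, Matrix.trace_mul_comm,
    ← Matrix.mul_assoc, ← Matrix.mul_assoc, Matrix.mul_sub, Matrix.mul_one, Matrix.sub_mul,
    transpose_mul_self, Matrix.trace]
  refine Finset.sum_congr rfl fun k _ => ?_
  rw [Matrix.diag_apply, Matrix.mul_diagonal, Matrix.sub_apply, Matrix.one_apply_eq, mul_comm]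

/-! ### Haar averaging of estimators -/

section Estimators

instance haarO_isProbabilityMeasure (p : ℕ) : IsProbabilityMeasure (haarO p) :=
  ⟨Measure.haarMeasure_self⟩

instance haarO_isHaarMeasure (p : ℕ) : (haarO p).IsHaarMeasure := by
  unfold haarO; infer_instance

/-- A right translate of Haar measure is again a left Haar measure, here of mass 1; uniqueness
identifies the two. -/
theorem map_mul_right_haarO {p : ℕ} (g : OGroup p) : (haarO p).map (fun U => U * g) = haarO p := by
  have : IsProbabilityMeasure ((haarO p).map (fun U => U * g)) :=
    Measure.isProbabilityMeasure_map (continuous_mul_const g).measurable.aemeasurable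
  have : ((haarO p).map (fun U => U * g)).IsHaarMeasure :=
    Measure.isHaarMeasure_map_smul (haarO p) (MulOpposite.op g)
  exact Measure.isHaarMeasure_eq_of_isProbabilityMeasure _ _

variable {p d n : ℕ}

/-- The estimator in the coordinates given by the columns of `U`. -/
def rotatedEstimator (Phat : Estimator p d n) (U : OGroup p) (y : Fin n → Fin p → ℝ) : Mat p :=
  (U : Mat p).transpose * Phat.1 (fun k => observe U (y k)) * (U : Mat p)

theorem rotatedEstimator_mem (Phat : Estimator p d n) (U : OGroup p) (y : Fin n → Fin p → ℝ) :
    rotatedEstimator Phat U y ∈ projections p d :=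
  conj_mem_projections U (Phat.2.2 _)

theorem measurable_entry (k l : Fin p) : Measurable fun A : Mat p => A k l :=
  (measurable_pi_apply l).comp (measurable_pi_apply (X := fun _ : Fin p => Fin p → ℝ) k)

theorem measurable_orthogonal_entry (k l : Fin p) :
    Measurable fun U : OGroup p => (U : Mat p) k l :=
  (measurable_entry k l).comp measurable_subtype_coe

theorem measurable_rotatedEstimator (Phat : Estimator p d n) (k l : Fin p) :
    Measurable fun z : OGroup p × (Fin n → Fin p → ℝ) => rotatedEstimator Phat z.1 z.2 k l := by
  have hU : ∀ a b, Measurable fun z : OGroup p × (Fin n → Fin p → ℝ) => (z.1 : Mat p) a b :=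
    fun a b => (measurable_orthogonal_entry a b).comp measurable_fst
  have hobs : Measurable fun z : OGroup p × (Fin n → Fin p → ℝ) =>
      fun k => observe z.1 (z.2 k) := by
    refine measurable_pi_lambda _ fun k => ?_
    refine (MeasurableEquiv.toLp 2 (Fin p → ℝ)).measurable.comp (measurable_pi_lambda _ fun a => ?_)
    simp only [Matrix.mulVec, dotProduct]
    refine Finset.measurable_fun_sum _ fun b _ => (hU a b).mul ?_
    exact (measurable_pi_apply b).comp ((measurable_pi_apply k).comp measurable_snd)
  have hP : ∀ a b, Measurable fun z : OGroup p × (Fin n → Fin p → ℝ) =>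
      Phat.1 (fun k => observe z.1 (z.2 k)) a b :=
    fun a b => (measurable_entry a b).comp (Phat.2.1.comp hobs)
  simp only [rotatedEstimator, Matrix.mul_apply, Matrix.transpose_apply]
  exact Finset.measurable_fun_sum _ fun b _ => (Finset.measurable_fun_sum _ fun a _ =>
    (hU a k).mul (hP a b)).mul (hU b l)

theorem measurable_rotatedEstimator_left (Phat : Estimator p d n) (y : Fin n → Fin p → ℝ)
    (k l : Fin p) : Measurable fun U => rotatedEstimator Phat U y k l := by
  have h : Measurable fun U : OGroup p => (U, y) := measurable_prodMk_right
  simpa only [Function.comp_def] using (measurable_rotatedEstimator Phat k l).comp h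

/-- Observing gy in the frame U is observing y in the frame Ug; only the conjugation has to be
corrected, by inserting g gᵀ = 1. -/
theorem rotatedEstimator_rotate (Phat : Estimator p d n) (U g : OGroup p)
    (y : Fin n → Fin p → ℝ) :
    rotatedEstimator Phat U (fun k => (g : Mat p).mulVec (y k)) =
      (g : Mat p) * rotatedEstimator Phat (U * g) y * (g : Mat p).transpose := by
  have h1 : ∀ k, observe U ((g : Mat p).mulVec (y k)) = observe (U * g) (y k) := fun k => by
    simp [observe, Matrix.mulVec_mulVec]
  simp only [rotatedEstimator, h1]
  have hc : ((U * g : OGroup p) : Mat p) = (U : Mat p) * (g : Mat p) := rfl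
  rw [hc, Matrix.transpose_mul]
  generalize Phat.1 (fun k => observe (U * g) (y k)) = P
  calc (U : Mat p).transpose * P * (U : Mat p)
      = ((g : Mat p) * (g : Mat p).transpose) * ((U : Mat p).transpose * P * (U : Mat p)) *
        ((g : Mat p) * (g : Mat p).transpose) := by
        rw [self_mul_transpose, Matrix.one_mul, Matrix.mul_one]
    _ = _ := by simp only [Matrix.mul_assoc]

/-- The average of the rotated estimators over the orthogonal group. -/
def meanEstimator (Phat : Estimator p d n) (y : Fin n → Fin p → ℝ) : Mat p :=
  Matrix.of fun k l => ∫ U, rotatedEstimator Phat U y k l ∂(haarO p)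

theorem integrable_rotatedEstimator (Phat : Estimator p d n) (y : Fin n → Fin p → ℝ)
    (k l : Fin p) : Integrable (fun U => rotatedEstimator Phat U y k l) (haarO p) :=
  integrable_of_abs_le (measurable_rotatedEstimator_left Phat y k l) 1
    fun U => projections_abs_le_one (rotatedEstimator_mem Phat U y) k l

theorem integrable_rotatedEstimator_sq (Phat : Estimator p d n) (y : Fin n → Fin p → ℝ)
    (k l : Fin p) : Integrable (fun U => rotatedEstimator Phat U y k l ^ 2) (haarO p) := by
  refine integrable_of_abs_le
    ((measurable_rotatedEstimator_left Phat y k l).pow_const 2) 1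
    fun U => ?_
  rw [abs_pow]
  exact pow_le_one₀ (abs_nonneg _) (projections_abs_le_one (rotatedEstimator_mem Phat U y) k l)

theorem measurable_meanEstimator (Phat : Estimator p d n) (k l : Fin p) :
    Measurable fun y => meanEstimator Phat y k l := by
  have h := (measurable_rotatedEstimator Phat k l).comp measurable_swap
  exact (h.stronglyMeasurable.integral_prod_right' (ν := haarO p)).measurable

/-- Right invariance of Haar measure absorbs the shift from U to Ug. This equivariance holds for
every y, not only on average. -/
theorem meanEstimator_rotate (Phat : Estimator p d n) (g : OGroup p) (y : Fin n → Fin p → ℝ) :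
    meanEstimator Phat (fun k => (g : Mat p).mulVec (y k)) =
      (g : Mat p) * meanEstimator Phat y * (g : Mat p).transpose := by
  ext k l
  have hent : ∀ A : Mat p, ((g : Mat p) * A * (g : Mat p).transpose) k l =
      ∑ b, ∑ a, (g : Mat p) k a * (g : Mat p) l b * A a b := by
    intro A
    rw [Matrix.mul_apply]
    refine Finset.sum_congr rfl fun b _ => ?_
    rw [Matrix.mul_apply, Finset.sum_mul, Matrix.transpose_apply]
    exact Finset.sum_congr rfl fun a _ => by ring
  have hinv : ∀ a b, ∫ U, rotatedEstimator Phat (U * g) y a b ∂(haarO p) =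
      meanEstimator Phat y a b := by
    intro a b
    rw [meanEstimator, Matrix.of_apply]
    conv_rhs => rw [← map_mul_right_haarO g]
    rw [integral_map (continuous_mul_const g).measurable.aemeasurable]
    exact (measurable_rotatedEstimator_left Phat y a b).aestronglyMeasurable
  have hint : ∀ a b, Integrable (fun U => rotatedEstimator Phat (U * g) y a b) (haarO p) :=
    fun a b => integrable_of_abs_le ((measurable_rotatedEstimator_left Phat y a b).comp (continuous_mul_const g).measurable) 1
      fun U => projections_abs_le_one (rotatedEstimator_mem Phat (U * g) y) a b
  rw [hent]
  simp_rw [← hinv]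
  rw [meanEstimator, Matrix.of_apply]
  simp_rw [rotatedEstimator_rotate, hent]
  rw [integral_finsetSum _ fun b _ => integrable_finsetSum _ fun a _ => (hint a b).const_mul _]
  refine Finset.sum_congr rfl fun b _ => ?_
  rw [integral_finsetSum _ fun a _ => (hint a b).const_mul _]
  exact Finset.sum_congr rfl fun a _ => integral_const_mul _ _

theorem meanEstimator_abs_le_one (Phat : Estimator p d n) (y : Fin n → Fin p → ℝ) (k l : Fin p) :
    |meanEstimator Phat y k l| ≤ 1 := by
  have := norm_integral_le_of_norm_le_const (μ := haarO p) (C := 1)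
    (f := fun U => rotatedEstimator Phat U y k l)
    (ae_of_all _ fun U => projections_abs_le_one (rotatedEstimator_mem Phat U y) k l)
  simpa [meanEstimator] using this

theorem meanEstimator_symm (Phat : Estimator p d n) (y : Fin n → Fin p → ℝ) (k l : Fin p) :
    meanEstimator Phat y l k = meanEstimator Phat y k l := by
  simp only [meanEstimator, Matrix.of_apply]
  exact integral_congr_ae (ae_of_all _ fun U =>
    projections_symm (rotatedEstimator_mem Phat U y) k l)

theorem meanEstimator_trace (Phat : Estimator p d n) (y : Fin n → Fin p → ℝ) :
    ∑ k, meanEstimator Phat y k k = d := by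
  simp only [meanEstimator, Matrix.of_apply]
  rw [← integral_finsetSum _ fun k _ => integrable_rotatedEstimator Phat y k k]
  have : ∀ U, ∑ k, rotatedEstimator Phat U y k k = d := fun U =>
    projections_trace (rotatedEstimator_mem Phat U y)
  simp [this]

/-- The average m is in general no projection. The bound ∑_{l∈S} Q_kl² ≤ Q_kk - Q_kk² holds for each
Q_U, and Jensen passes it to m; its right side is at most Q_kk and at most 1 - Q_kk. -/
theorem meanEstimator_sum_sq_le (Phat : Estimator p d n) (y : Fin n → Fin p → ℝ) (k : Fin p)
    {S : Finset (Fin p)} (hS : k ∉ S) :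
    ∑ l ∈ S, meanEstimator Phat y k l ^ 2 ≤ meanEstimator Phat y k k ∧
      ∑ l ∈ S, meanEstimator Phat y k l ^ 2 ≤ 1 - meanEstimator Phat y k k := by
  have hjensen : ∀ l, meanEstimator Phat y k l ^ 2 ≤
      ∫ U, rotatedEstimator Phat U y k l ^ 2 ∂(haarO p) := by
    intro l
    have := sq_integral_mul_le (μ := haarO p) (g := fun _ => 1)
      (integrable_rotatedEstimator_sq Phat y k l) (by simp)
      (by simpa using integrable_rotatedEstimator Phat y k l)
    simpa [meanEstimator] using this
  have hpt : ∀ U, ∑ l ∈ S, rotatedEstimator Phat U y k l ^ 2 ≤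
      rotatedEstimator Phat U y k k - rotatedEstimator Phat U y k k ^ 2 := by
    intro U
    have h1 := projections_row_sq (rotatedEstimator_mem Phat U y) k
    have h2 := Finset.sum_le_univ_sum_of_nonneg (s := insert k S)
      (f := fun l => rotatedEstimator Phat U y k l ^ 2) (fun l => sq_nonneg _)
    rw [Finset.sum_insert hS, h1] at h2
    linarith
  have hsum : ∑ l ∈ S, meanEstimator Phat y k l ^ 2 ≤
      ∫ U, ∑ l ∈ S, rotatedEstimator Phat U y k l ^ 2 ∂(haarO p) := by
    rw [integral_finsetSum _ fun l _ => integrable_rotatedEstimator_sq Phat y k l]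
    exact Finset.sum_le_sum fun l _ => hjensen l
  have hsint : Integrable (fun U => ∑ l ∈ S, rotatedEstimator Phat U y k l ^ 2) (haarO p) :=
    integrable_finsetSum _ fun l _ => integrable_rotatedEstimator_sq Phat y k l
  have hkk := integrable_rotatedEstimator Phat y k k
  constructor
  · refine hsum.trans (integral_mono hsint hkk fun U => ?_)
    have := hpt U
    nlinarith [sq_nonneg (rotatedEstimator Phat U y k k)]
  · refine hsum.trans ?_
    have e : 1 - meanEstimator Phat y k k =
        ∫ U, (1 - rotatedEstimator Phat U y k k) ∂(haarO p) := by
      rw [integral_sub (integrable_const 1) hkk]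
      simp [meanEstimator]
    rw [e]
    refine integral_mono hsint ((integrable_const 1).sub hkk) fun U => ?_
    have := hpt U
    simp only
    nlinarith [sq_nonneg (1 - rotatedEstimator Phat U y k k)]

/-! ### The averaged risk through mean diagonal entries -/

/-- The reconstruction error of a projection under the diagonal covariance matrix. -/
def diagonalRisk (lam : ℕ → ℝ) (Q : Mat p) : ℝ :=
  ∑ k : Fin p, lam (k.val + 1) * (1 - Q k k)

/-- The minimal reconstruction error. -/
def minimalRisk (p d : ℕ) (lam : ℕ → ℝ) : ℝ :=
  sInf (diagonalRisk lam '' projections p d)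

variable {lam : ℕ → ℝ}

/-- Conjugation by U permutes the projections of rank d, so the minimal risk does not depend on U.
-/
theorem image_reconstructionError (hpos : ∀ k : Fin p, 0 < lam (k.val + 1)) (U : OGroup p) :
    reconstructionError lam U '' projections p d = diagonalRisk lam '' projections p d := by
  ext t
  constructor
  · rintro ⟨P, hP, rfl⟩
    exact ⟨_, conj_mem_projections U hP, (reconstructionError_eq hpos U hP).symm⟩
  · rintro ⟨Q, hQ, rfl⟩
    have hP := conj_mem_projections (U⁻¹) hQ
    refine ⟨_, hP, ?_⟩
    rw [reconstructionError_eq hpos U hP]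
    have h1 : ((U⁻¹ : OGroup p) : Mat p) = (U : Mat p).transpose := rfl
    have : (U : Mat p).transpose * (((U⁻¹ : OGroup p) : Mat p).transpose * Q *
        ((U⁻¹ : OGroup p) : Mat p)) * (U : Mat p) = Q := by
      rw [h1, Matrix.transpose_transpose]
      calc _ = ((U : Mat p).transpose * (U : Mat p)) * Q *
            ((U : Mat p).transpose * (U : Mat p)) := by simp only [Matrix.mul_assoc]
        _ = Q := by rw [transpose_mul_self, Matrix.one_mul, Matrix.mul_one]
    rw [this, diagonalRisk]

theorem excessRisk_eq (hpos : ∀ k : Fin p, 0 < lam (k.val + 1)) (U : OGroup p) {P : Mat p}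
    (hP : P ∈ projections p d) : excessRisk d lam U P =
      diagonalRisk lam ((U : Mat p).transpose * P * (U : Mat p)) - minimalRisk p d lam := by
  rw [excessRisk, image_reconstructionError hpos, reconstructionError_eq hpos U hP]
  rfl

theorem abs_diagonalRisk_le (hpos : ∀ k : Fin p, 0 < lam (k.val + 1)) {Q : Mat p}
    (hQ : Q ∈ projections p d) : |diagonalRisk lam Q| ≤ ∑ k : Fin p, lam (k.val + 1) := by
  refine (Finset.abs_sum_le_sum_abs _ _).trans (Finset.sum_le_sum fun k _ => ?_)
  have h0 := projections_diag_nonneg hQ k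
  have h1 := projections_diag_le_one hQ k
  rw [abs_of_nonneg (mul_nonneg (hpos k).le (by linarith))]
  nlinarith [hpos k]

theorem measurable_diagonalRisk (lam : ℕ → ℝ) :
    Measurable fun Q : Mat p => diagonalRisk lam Q := by
  unfold diagonalRisk
  exact Finset.measurable_fun_sum _ fun k _ => ((measurable_entry k k).const_sub 1).const_mul _

theorem integrable_excessRisk (hpos : ∀ k : Fin p, 0 < lam (k.val + 1)) (Phat : Estimator p d n)
    (U : OGroup p) :
    Integrable (fun X => excessRisk d lam U (Phat.1 X)) (sampleLaw n lam U) := by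
  have hprob : IsProbabilityMeasure (gaussianLaw lam U) := by
    unfold gaussianLaw; infer_instance
  have hprob' : IsProbabilityMeasure (sampleLaw n lam U) := by
    unfold sampleLaw; infer_instance
  simp_rw [fun X => excessRisk_eq hpos U (Phat.2.2 X)]
  refine Integrable.sub (integrable_of_abs_le ?_ _ fun X =>
    abs_diagonalRisk_le hpos (conj_mem_projections U (Phat.2.2 X))) (integrable_const _)
  refine (measurable_diagonalRisk lam).comp ?_
  have hc : Continuous fun P : Mat p => (U : Mat p).transpose * P * (U : Mat p) := by fun_prop
  exact hc.measurable.comp Phat.2.1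

theorem measurable_diagonalRisk_rotatedEstimator (Phat : Estimator p d n) :
    Measurable fun z : OGroup p × (Fin n → Fin p → ℝ) =>
      diagonalRisk lam (rotatedEstimator Phat z.1 z.2) := by
  unfold diagonalRisk
  exact Finset.measurable_fun_sum _ fun k _ =>
    ((measurable_rotatedEstimator Phat k k).const_sub 1).const_mul _

theorem expectedExcessRisk_eq (hpos : ∀ k : Fin p, 0 < lam (k.val + 1)) (Phat : Estimator p d n)
    (U : OGroup p) : expectedExcessRisk lam Phat U =
      (∫ y, diagonalRisk lam (rotatedEstimator Phat U y) ∂(coordSampleLaw n (eigVar p lam))) -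
        minimalRisk p d lam := by
  have hm : Measurable fun (y : Fin n → Fin p → ℝ) k => observe U (y k) :=
    measurable_pi_lambda _ fun k => (measurable_observe U).comp (measurable_pi_apply k)
  have hae := (integrable_excessRisk hpos Phat U).aestronglyMeasurable
  rw [expectedExcessRisk]
  rw [sampleLaw_eq_map hpos] at hae ⊢
  rw [integral_map hm.aemeasurable hae]
  simp_rw [fun X => excessRisk_eq hpos U (Phat.2.2 X)]
  rw [integral_sub]
  · simp [rotatedEstimator]
  · have h : Measurable fun y : Fin n → Fin p → ℝ => (U, y) := measurable_prodMk_left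
    have h2 := (measurable_diagonalRisk_rotatedEstimator (lam := lam) Phat).comp h
    rw [Function.comp_def] at h2
    exact integrable_of_abs_le h2 _ fun y => abs_diagonalRisk_le hpos (rotatedEstimator_mem Phat U y)
  · exact integrable_const _

theorem integrable_diagonalRisk_prod (hpos : ∀ k : Fin p, 0 < lam (k.val + 1))
    (Phat : Estimator p d n) :
    Integrable (fun z : OGroup p × (Fin n → Fin p → ℝ) =>
      diagonalRisk lam (rotatedEstimator Phat z.1 z.2))
      ((haarO p).prod (coordSampleLaw n (eigVar p lam))) :=
  integrable_of_abs_le (measurable_diagonalRisk_rotatedEstimator Phat) _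
    fun z => abs_diagonalRisk_le hpos (rotatedEstimator_mem Phat z.1 z.2)

theorem integrable_expectedExcessRisk (hpos : ∀ k : Fin p, 0 < lam (k.val + 1))
    (Phat : Estimator p d n) : Integrable (expectedExcessRisk lam Phat) (haarO p) := by
  rw [funext (expectedExcessRisk_eq hpos Phat)]
  exact (integrable_diagonalRisk_prod hpos Phat).integral_prod_left.sub (integrable_const _)

/-- The mean of a diagonal entry of the averaged estimator. -/
def meanEntry (lam : ℕ → ℝ) (Phat : Estimator p d n) (k : Fin p) : ℝ :=
  ∫ y, meanEstimator Phat y k k ∂(coordSampleLaw n (eigVar p lam))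

theorem integrable_meanEstimator (Phat : Estimator p d n) (k l : Fin p) :
    Integrable (fun y => meanEstimator Phat y k l) (coordSampleLaw n (eigVar p lam)) :=
  integrable_of_abs_le (measurable_meanEstimator Phat k l) 1
    fun y => meanEstimator_abs_le_one Phat y k l

theorem averagedExcessRisk_eq (hpos : ∀ k : Fin p, 0 < lam (k.val + 1)) (Phat : Estimator p d n) :
    averagedExcessRisk lam Phat =
      (∑ k : Fin p, lam (k.val + 1) * (1 - meanEntry lam Phat k)) - minimalRisk p d lam := by
  rw [averagedExcessRisk, funext (expectedExcessRisk_eq hpos Phat), integral_sub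
    (integrable_diagonalRisk_prod hpos Phat).integral_prod_left (integrable_const _),
    integral_integral_swap (integrable_diagonalRisk_prod hpos Phat)]
  have h1 : ∀ y, ∫ U, diagonalRisk lam (rotatedEstimator Phat U y) ∂(haarO p) =
      ∑ k : Fin p, lam (k.val + 1) * (1 - meanEstimator Phat y k k) := by
    intro y
    have hi : ∀ k, Integrable (fun U => 1 - rotatedEstimator Phat U y k k) (haarO p) :=
      fun k => (integrable_const 1).sub (integrable_rotatedEstimator Phat y k k)
    simp only [diagonalRisk]
    rw [integral_finsetSum _ fun k _ => (hi k).const_mul _]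
    refine Finset.sum_congr rfl fun k _ => ?_
    rw [integral_const_mul, integral_sub (integrable_const 1)
      (integrable_rotatedEstimator Phat y k k)]
    simp [meanEstimator]
  simp_rw [h1]
  have hi : ∀ k, Integrable (fun y => 1 - meanEstimator Phat y k k)
      (coordSampleLaw n (eigVar p lam)) :=
    fun k => (integrable_const 1).sub (integrable_meanEstimator Phat k k)
  rw [integral_finsetSum _ fun k _ => (hi k).const_mul _]
  congr 1
  · refine Finset.sum_congr rfl fun k _ => ?_
    rw [integral_const_mul, integral_sub (integrable_const 1) (integrable_meanEstimator Phat k k)]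
    simp [meanEntry]
  · simp

/-- Tested on the projection onto the first d coordinates. The minimum enters the excess risk with a
minus sign, so this upper bound suffices. -/
theorem minimalRisk_le (hpos : ∀ k : Fin p, 0 < lam (k.val + 1)) (hdp : d ≤ p) :
    minimalRisk p d lam ≤ ∑ k : Fin p, lam (k.val + 1) * (if k.val < d then 0 else 1) := by
  let Q : Mat p := Matrix.diagonal fun k => if k.val < d then 1 else 0
  have hQ : Q ∈ projections p d := by
    refine mem_projections_of (Matrix.diagonal_transpose _) ?_ ?_
    · simp only [Q, Matrix.diagonal_mul_diagonal]
      congr 1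
      ext k
      split_ifs <;> simp
    · rw [Matrix.rank_diagonal]
      have : ∀ k : Fin p, (if k.val < d then (1 : ℝ) else 0) ≠ 0 ↔ k.val < d := fun k => by simp
      simp_rw [this]
      rw [Fintype.card_subtype, Fin.card_filter_val_lt, min_eq_right hdp]
  refine csInf_le ⟨-∑ k : Fin p, lam (k.val + 1), ?_⟩ ⟨Q, hQ, ?_⟩
  · rintro _ ⟨P, hP, rfl⟩
    exact (abs_le.mp (abs_diagonalRisk_le hpos hP)).1
  · refine Finset.sum_congr rfl fun k _ => ?_
    simp only [Q, Matrix.diagonal_apply_eq]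
    split_ifs <;> simp

end Estimators

/-! ### The linear program and the deterministic bound -/

/-- The maximum of the objective over the feasible arrays is attained. -/
theorem exists_isGreatest_objectiveValues {p n r s : ℕ} {lam : ℕ → ℝ} {μ : ℝ}
    (hb : ∀ i ∈ Finset.Icc 1 r, ∀ j ∈ Finset.Ioc s p,
      0 ≤ 1 / (n : ℝ) * (lam i * lam j / (lam i - lam j)))
    (hcol : ∀ j ∈ Finset.Ioc s p, lam j ≤ μ) (hrow : ∀ i ∈ Finset.Icc 1 r, μ ≤ lam i) :
    ∃ M, IsGreatest (objectiveValues p n r s lam μ) M := by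
  let f : (ℕ → ℕ → ℝ) → ℝ := fun x => ∑ i ∈ Finset.Icc 1 r, ∑ j ∈ Finset.Ioc s p, x i j
  -- Entries outside the index block are forced to be 0, so the box is compact although arrays are
  -- indexed by all of ℕ × ℕ.
  let K : Set (ℕ → ℕ → ℝ) := {x | ∀ i, x i ∈ {z : ℕ → ℝ | ∀ j, z j ∈ Set.Icc (0 : ℝ)
    (if i ∈ Finset.Icc 1 r ∧ j ∈ Finset.Ioc s p then
      1 / (n : ℝ) * (lam i * lam j / (lam i - lam j)) else 0)}}
  have hK : IsCompact K := isCompact_pi_infinite fun i => isCompact_pi_infinite fun j => isCompact_Icc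
  have hev : ∀ i j, Continuous fun x : ℕ → ℕ → ℝ => x i j := fun i j => by fun_prop
  let F : Set (ℕ → ℕ → ℝ) :=
    (⋂ j ∈ Finset.Ioc s p, {x | ∑ i ∈ Finset.Icc 1 r, x i j ≤ μ - lam j}) ∩
    (⋂ i ∈ Finset.Icc 1 r, {x | ∑ j ∈ Finset.Ioc s p, x i j ≤ lam i - μ})
  have hF : IsClosed F := by
    refine IsClosed.inter (isClosed_biInter fun j _ => ?_) (isClosed_biInter fun i _ => ?_)
    · exact isClosed_le (continuous_finsetSum _ fun i _ => hev i j) continuous_const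
    · exact isClosed_le (continuous_finsetSum _ fun j _ => hev i j) continuous_const
  have hne : (K ∩ F).Nonempty := by
    refine ⟨fun _ _ => 0, fun i j => ⟨le_rfl, ?_⟩, ?_, ?_⟩
    · split_ifs with h
      · exact hb i h.1 j h.2
      · exact le_rfl
    · simp only [Set.mem_iInter, Set.mem_ofPred_eq]
      intro j hj
      simpa using hcol j hj
    · simp only [Set.mem_iInter, Set.mem_ofPred_eq]
      intro i hi
      simpa using hrow i hi
  have hf : Continuous f := continuous_finsetSum _ fun i _ => continuous_finsetSum _ fun j _ => hev i j
  obtain ⟨x, hx, hmax⟩ := (hK.inter_right hF).exists_isMaxOn hne hf.continuousOn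
  have hxK : ∀ i j, x i j ∈ Set.Icc (0 : ℝ) (if i ∈ Finset.Icc 1 r ∧ j ∈ Finset.Ioc s p then
      1 / (n : ℝ) * (lam i * lam j / (lam i - lam j)) else 0) := hx.1
  have hxF := hx.2
  simp only [F, Set.mem_inter_iff, Set.mem_iInter, Set.mem_ofPred_eq] at hxF
  refine ⟨f x, ⟨x, ⟨fun i hi j hj => (hxK i j).1, fun i hi j hj => ?_, hxF.1, hxF.2⟩, rfl⟩, ?_⟩
  · have := (hxK i j).2
    rwa [if_pos ⟨hi, hj⟩] at this
  · rintro _ ⟨y, hy, rfl⟩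
    -- A feasible array is arbitrary outside the block; truncation brings it into K without changing
    -- the objective.
    let z : ℕ → ℕ → ℝ := fun i j => if i ∈ Finset.Icc 1 r ∧ j ∈ Finset.Ioc s p then y i j else 0
    have hzy : ∀ i ∈ Finset.Icc 1 r, ∀ j ∈ Finset.Ioc s p, z i j = y i j := fun i hi j hj =>
      if_pos ⟨hi, hj⟩
    have hz : z ∈ K ∩ F := by
      refine ⟨fun i j => ?_, ?_, ?_⟩
      · by_cases h : i ∈ Finset.Icc 1 r ∧ j ∈ Finset.Ioc s p
        · rw [hzy i h.1 j h.2, if_pos h]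
          exact ⟨hy.nonneg i h.1 j h.2, hy.le_bound i h.1 j h.2⟩
        · simp only [z, if_neg h]
          exact ⟨le_rfl, le_rfl⟩
      · simp only [Set.mem_iInter, Set.mem_ofPred_eq]
        intro j hj
        rw [Finset.sum_congr rfl fun i hi => hzy i hi j hj]
        exact hy.col_sum_le j hj
      · simp only [Set.mem_iInter, Set.mem_ofPred_eq]
        intro i hi
        rw [Finset.sum_congr rfl fun j hj => hzy i hi j hj]
        exact hy.row_sum_le i hi
    have h1 : f z ≤ f x := hmax hz
    have h2 : f z = ∑ i ∈ Finset.Icc 1 r, ∑ j ∈ Finset.Ioc s p, y i j :=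
      Finset.sum_congr rfl fun i hi => Finset.sum_congr rfl fun j hj => hzy i hi j hj
    rw [← h2]
    exact h1

/-- The deterministic optimization: an excess risk with diagonal entries `a k` and squared
off-diagonal entries `C i j` that satisfy the information inequalities is bounded below by one
third of the objective of every feasible array. -/
theorem sum_feasible_le {p d n r s : ℕ} {lam : ℕ → ℝ} {μ : ℝ} (hn : 1 ≤ n)
    (hrd : r ≤ d) (hds : d ≤ s) (hdp : d ≤ p)
    (hpos : ∀ k ∈ Finset.Icc 1 p, 0 < lam k)
    (hup : ∀ i ∈ Finset.Icc 1 d, μ ≤ lam i) (hlow : ∀ j ∈ Finset.Ioc d p, lam j ≤ μ)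
    (hgap : ∀ i ∈ Finset.Icc 1 r, ∀ j ∈ Finset.Ioc s p, lam j < lam i)
    {a : ℕ → ℝ} {C : ℕ → ℕ → ℝ}
    (ha0 : ∀ k ∈ Finset.Icc 1 p, 0 ≤ a k) (ha1 : ∀ k ∈ Finset.Icc 1 p, a k ≤ 1)
    (hsum : ∑ k ∈ Finset.Icc 1 p, a k = d)
    (hrow : ∀ i ∈ Finset.Icc 1 r, ∑ j ∈ Finset.Ioc s p, C i j ≤ 1 - a i)
    (hcol : ∀ j ∈ Finset.Ioc s p, ∑ i ∈ Finset.Icc 1 r, C i j ≤ a j)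
    (hinfo : ∀ i ∈ Finset.Icc 1 r, ∀ j ∈ Finset.Ioc s p,
      (a i - a j) ^ 2 ≤ n * ((lam i - lam j) ^ 2 / (lam i * lam j)) * C i j)
    {x : ℕ → ℕ → ℝ} (hx : Feasible p n r s lam μ x) :
    1 / 3 * ∑ i ∈ Finset.Icc 1 r, ∑ j ∈ Finset.Ioc s p, x i j ≤
      (∑ k ∈ Finset.Icc 1 d, lam k * (1 - a k)) - ∑ k ∈ Finset.Ioc d p, lam k * a k := by
  have hsplit : ∑ k ∈ Finset.Icc 1 p, a k =
      (∑ k ∈ Finset.Icc 1 d, a k) + ∑ k ∈ Finset.Ioc d p, a k := by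
    rw [← Finset.sum_union (Finset.disjoint_left.mpr fun k h1 h2 => by
      simp only [Finset.mem_Icc, Finset.mem_Ioc] at h1 h2; omega)]
    congr 1
    ext k
    simp only [Finset.mem_Icc, Finset.mem_Ioc, Finset.mem_union]
    omega
  have hbal : ∑ k ∈ Finset.Icc 1 d, (1 - a k) = ∑ k ∈ Finset.Ioc d p, a k := by
    rw [Finset.sum_sub_distrib]
    simp only [Finset.sum_const, Nat.card_Icc, nsmul_eq_mul]
    rw [Nat.add_sub_cancel, mul_one]
    linarith
  -- The trace balance allows μ to be subtracted from every eigenvalue at no cost, after which all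
  -- terms are nonnegative.
  have hrisk : (∑ k ∈ Finset.Icc 1 d, lam k * (1 - a k)) - ∑ k ∈ Finset.Ioc d p, lam k * a k =
      (∑ k ∈ Finset.Icc 1 d, (lam k - μ) * (1 - a k)) + ∑ k ∈ Finset.Ioc d p, (μ - lam k) * a k := by
    simp_rw [sub_mul, Finset.sum_sub_distrib, ← Finset.mul_sum, hbal]
    ring
  have hmemI : ∀ i ∈ Finset.Icc 1 r, i ∈ Finset.Icc 1 d ∧ i ∈ Finset.Icc 1 p := fun i hi => by
    simp only [Finset.mem_Icc] at hi ⊢; omega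
  have hmemJ : ∀ j ∈ Finset.Ioc s p, j ∈ Finset.Ioc d p ∧ j ∈ Finset.Icc 1 p := fun j hj => by
    simp only [Finset.mem_Icc, Finset.mem_Ioc] at hj ⊢; omega
  have hI : ∑ i ∈ Finset.Icc 1 r, (lam i - μ) * (1 - a i) ≤
      ∑ k ∈ Finset.Icc 1 d, (lam k - μ) * (1 - a k) := by
    refine Finset.sum_le_sum_of_subset_of_nonneg (fun i hi => (hmemI i hi).1) fun k hk _ => ?_
    have hk' : k ∈ Finset.Icc 1 p := by simp only [Finset.mem_Icc] at hk ⊢; omega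
    exact mul_nonneg (sub_nonneg.mpr (hup k hk)) (sub_nonneg.mpr (ha1 k hk'))
  have hJ : ∑ j ∈ Finset.Ioc s p, (μ - lam j) * a j ≤ ∑ k ∈ Finset.Ioc d p, (μ - lam k) * a k := by
    refine Finset.sum_le_sum_of_subset_of_nonneg (fun j hj => (hmemJ j hj).1) fun k hk _ => ?_
    have hk' : k ∈ Finset.Icc 1 p := by simp only [Finset.mem_Icc, Finset.mem_Ioc] at hk ⊢; omega
    exact mul_nonneg (sub_nonneg.mpr (hlow k hk)) (ha0 k hk')
  -- Each (λ_i - μ)(1 - a_i) is used twice: a third of it with 1 - a_i ≥ ∑_j C_ij, two thirds with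
  -- λ_i - μ ≥ ∑_j x_ij.
  have hI' : ∑ i ∈ Finset.Icc 1 r, ∑ j ∈ Finset.Ioc s p,
      (1 / 3 * ((lam i - μ) * C i j) + 2 / 3 * (x i j * (1 - a i))) ≤
      ∑ i ∈ Finset.Icc 1 r, (lam i - μ) * (1 - a i) := by
    refine Finset.sum_le_sum fun i hi => ?_
    rw [Finset.sum_add_distrib, ← Finset.mul_sum, ← Finset.mul_sum, ← Finset.mul_sum,
      ← Finset.sum_mul]
    have h1 := mul_le_mul_of_nonneg_left (hrow i hi) (sub_nonneg.mpr (hup i (hmemI i hi).1))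
    have h2 := mul_le_mul_of_nonneg_right (hx.row_sum_le i hi)
      (sub_nonneg.mpr (ha1 i (hmemI i hi).2))
    linarith
  have hJ' : ∑ i ∈ Finset.Icc 1 r, ∑ j ∈ Finset.Ioc s p,
      (1 / 3 * ((μ - lam j) * C i j) + 2 / 3 * (x i j * a j)) ≤
      ∑ j ∈ Finset.Ioc s p, (μ - lam j) * a j := by
    rw [Finset.sum_comm]
    refine Finset.sum_le_sum fun j hj => ?_
    rw [Finset.sum_add_distrib, ← Finset.mul_sum, ← Finset.mul_sum, ← Finset.mul_sum,
      ← Finset.sum_mul]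
    have h1 := mul_le_mul_of_nonneg_left (hcol j hj) (sub_nonneg.mpr (hlow j (hmemJ j hj).1))
    have h2 := mul_le_mul_of_nonneg_right (hx.col_sum_le j hj) (ha0 j (hmemJ j hj).2)
    linarith
  have hterm : 1 / 3 * ∑ i ∈ Finset.Icc 1 r, ∑ j ∈ Finset.Ioc s p, x i j ≤
      ∑ i ∈ Finset.Icc 1 r, ∑ j ∈ Finset.Ioc s p,
        ((1 / 3 * ((lam i - μ) * C i j) + 2 / 3 * (x i j * (1 - a i))) +
          (1 / 3 * ((μ - lam j) * C i j) + 2 / 3 * (x i j * a j))) := by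
    rw [Finset.mul_sum]
    refine Finset.sum_le_sum fun i hi => ?_
    rw [Finset.mul_sum]
    refine Finset.sum_le_sum fun j hj => ?_
    have hli := hpos i (hmemI i hi).2
    have hlj := hpos j (hmemJ j hj).2
    have hg : 0 < lam i - lam j := sub_pos.mpr (hgap i hi j hj)
    have hn0 : (0 : ℝ) < n := by exact_mod_cast hn
    have h1 : x i j * (a i - a j) ^ 2 ≤ (lam i - lam j) * C i j := by
      calc x i j * (a i - a j) ^ 2
          ≤ 1 / (n : ℝ) * (lam i * lam j / (lam i - lam j)) * (a i - a j) ^ 2 :=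
            mul_le_mul_of_nonneg_right (hx.le_bound i hi j hj) (sq_nonneg _)
        _ ≤ 1 / (n : ℝ) * (lam i * lam j / (lam i - lam j)) *
            (n * ((lam i - lam j) ^ 2 / (lam i * lam j)) * C i j) :=
            mul_le_mul_of_nonneg_left (hinfo i hi j hj) (by positivity)
        _ = _ := by field_simp
    -- The μ terms cancel, leaving (λ_i - λ_j)C_ij + 2x_ij(1 - t) ≥ x_ij(t² + 2 - 2t) = x_ij(1 + (1
    -- - t)²), where t = a_i - a_j.
    nlinarith [mul_nonneg (hx.nonneg i hi j hj) (sq_nonneg (1 - a i + a j))]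
  simp_rw [Finset.sum_add_distrib] at hterm hI' hJ'
  rw [hrisk]
  linarith

/-! ### The bound for one estimator and the theorem -/

theorem sum_fin_eq_sum_Icc (p : ℕ) (f : ℕ → ℝ) :
    ∑ k : Fin p, f (k.val + 1) = ∑ k ∈ Finset.Icc 1 p, f k := by
  rw [Fin.sum_univ_eq_sum_range (fun k => f (k + 1)) p, Finset.range_eq_Ico,
    Finset.sum_Ico_add' f 0 p 1]
  rfl

/-- The lower bound for a single estimator. -/
theorem le_averagedExcessRisk {p d n r s : ℕ} (hn : 1 ≤ n) {lam : ℕ → ℝ} {μ : ℝ}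
    (hrd : r ≤ d) (hds : d ≤ s) (hdp : d < p)
    (hpos : ∀ k ∈ Finset.Icc 1 p, 0 < lam k)
    (hup : ∀ i ∈ Finset.Icc 1 d, μ ≤ lam i) (hlow : ∀ j ∈ Finset.Ioc d p, lam j ≤ μ)
    (hgap : ∀ i ∈ Finset.Icc 1 r, ∀ j ∈ Finset.Ioc s p, lam j < lam i)
    (Phat : Estimator p d n) {x : ℕ → ℕ → ℝ} (hx : Feasible p n r s lam μ x) :
    1 / 3 * ∑ i ∈ Finset.Icc 1 r, ∑ j ∈ Finset.Ioc s p, x i j ≤ averagedExcessRisk lam Phat := by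
  have hpos' : ∀ k : Fin p, 0 < lam (k.val + 1) := fun k =>
    hpos _ (Finset.mem_Icc.mpr ⟨by omega, k.isLt⟩)
  have hv : ∀ k, eigVar p lam k ≠ 0 := fun k => (Real.toNNReal_pos.mpr (hpos' k)).ne'
  have hvc : ∀ k, (eigVar p lam k : ℝ) = lam (k.val + 1) := fun k =>
    Real.coe_toNNReal _ (hpos' k).le
  set ν := coordSampleLaw n (eigVar p lam) with hν
  -- Inverse of the shift from `Fin p` to 1, …, p; outside this range the value is a dummy.
  let e : ℕ → Fin p := fun k => if h : k - 1 < p then ⟨k - 1, h⟩ else ⟨0, by omega⟩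
  have he : ∀ k : Fin p, e (k.val + 1) = k := fun k => by
    simp only [e, Nat.add_sub_cancel, k.isLt, dif_pos]
  have hev : ∀ k ∈ Finset.Icc 1 p, (e k).val + 1 = k := fun k hk => by
    have := Finset.mem_Icc.mp hk
    have h2 : k - 1 < p := by omega
    simp only [e, dif_pos h2]
    omega
  have hinj : ∀ S : Finset ℕ, S ⊆ Finset.Icc 1 p → Set.InjOn e S := fun S hS k hk l hl h => by
    rw [← hev k (hS hk), ← hev l (hS hl), h]
  let C : Fin p → Fin p → ℝ := fun k l => ∫ y, meanEstimator Phat y k l ^ 2 ∂ν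
  have hCint : ∀ k l, Integrable (fun y => meanEstimator Phat y k l ^ 2) ν := fun k l => by
    refine integrable_of_abs_le ((measurable_meanEstimator Phat k l).pow_const 2) 1 fun y => ?_
    rw [abs_pow]
    exact pow_le_one₀ (abs_nonneg _) (meanEstimator_abs_le_one Phat y k l)
  have hmint : ∀ k, Integrable (fun y => meanEstimator Phat y k k) ν :=
    fun k => integrable_meanEstimator Phat k k
  have hCsum : ∀ (k : Fin p) (S : Finset (Fin p)), k ∉ S →
      ∑ l ∈ S, C k l ≤ meanEntry lam Phat k ∧ ∑ l ∈ S, C k l ≤ 1 - meanEntry lam Phat k := by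
    intro k S hS
    have e1 : ∑ l ∈ S, C k l = ∫ y, ∑ l ∈ S, meanEstimator Phat y k l ^ 2 ∂ν :=
      (integral_finsetSum _ fun l _ => hCint k l).symm
    have e2 : 1 - meanEntry lam Phat k = ∫ y, (1 - meanEstimator Phat y k k) ∂ν := by
      rw [integral_sub (integrable_const 1) (hmint k)]
      simp [meanEntry, hν]
    have hi : Integrable (fun y => ∑ l ∈ S, meanEstimator Phat y k l ^ 2) ν :=
      integrable_finsetSum _ fun l _ => hCint k l
    rw [e2, e1]
    exact ⟨integral_mono hi (hmint k) fun y => (meanEstimator_sum_sq_le Phat y k hS).1,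
      integral_mono hi ((integrable_const 1).sub (hmint k))
        fun y => (meanEstimator_sum_sq_le Phat y k hS).2⟩
  have hCsymm : ∀ k l, C k l = C l k := fun k l => by
    simp only [C]
    simp_rw [meanEstimator_symm Phat _ k l]
  have hsub1 : Finset.Icc 1 r ⊆ Finset.Icc 1 p := Finset.Icc_subset_Icc_right (by omega)
  have hsub2 : Finset.Ioc s p ⊆ Finset.Icc 1 p := fun j hj => by
    simp only [Finset.mem_Icc, Finset.mem_Ioc] at hj ⊢; omega
  -- The empty set of off-diagonal entries already gives 0 ≤ a_k and 0 ≤ 1 - a_k.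
  have hbound : 0 ≤ meanEntry lam Phat ∧ meanEntry lam Phat ≤ 1 :=
    ⟨fun k => by simpa using (hCsum k ∅ (by simp)).1,
      fun k => by simpa using (hCsum k ∅ (by simp)).2⟩
  have hmain := sum_feasible_le (a := fun k => meanEntry lam Phat (e k))
    (C := fun i j => C (e i) (e j)) hn hrd hds hdp.le hpos hup hlow hgap
    (fun k _ => hbound.1 _) (fun k _ => hbound.2 _) ?_ ?_ ?_ ?_ hx
  · refine hmain.trans ?_
    have hmin := minimalRisk_le hpos' hdp.le
    rw [averagedExcessRisk_eq hpos']
    have h1 : ∑ k : Fin p, lam (k.val + 1) * (1 - meanEntry lam Phat k) =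
        ∑ k ∈ Finset.Icc 1 p, lam k * (1 - meanEntry lam Phat (e k)) := by
      rw [← sum_fin_eq_sum_Icc p fun k => lam k * (1 - meanEntry lam Phat (e k))]
      simp_rw [he]
    have h2 : ∑ k : Fin p, lam (k.val + 1) * (if k.val < d then (0 : ℝ) else 1) =
        ∑ k ∈ Finset.Icc 1 p, lam k * (if k ≤ d then 0 else 1) :=
      sum_fin_eq_sum_Icc p fun k => lam k * (if k ≤ d then 0 else 1)
    have h3 : ∀ f : ℕ → ℝ, ∑ k ∈ Finset.Icc 1 p, f k =
        (∑ k ∈ Finset.Icc 1 d, f k) + ∑ k ∈ Finset.Ioc d p, f k := by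
      intro f
      rw [← Finset.sum_union (Finset.disjoint_left.mpr fun k h1 h2 => by
        simp only [Finset.mem_Icc, Finset.mem_Ioc] at h1 h2; omega)]
      congr 1
      ext k
      simp only [Finset.mem_Icc, Finset.mem_Ioc, Finset.mem_union]
      omega
    rw [h2, h3, Finset.sum_congr rfl fun k hk => by rw [if_pos (Finset.mem_Icc.mp hk).2],
      Finset.sum_congr (s₁ := Finset.Ioc d p) rfl fun k hk => by
        rw [if_neg (not_le.mpr (Finset.mem_Ioc.mp hk).1)]] at hmin
    rw [h1, h3]
    simp only [mul_zero, mul_one, Finset.sum_const_zero, zero_add] at hmin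
    have h4 : ∑ k ∈ Finset.Ioc d p, lam k * (1 - meanEntry lam Phat (e k)) =
        (∑ k ∈ Finset.Ioc d p, lam k) - ∑ k ∈ Finset.Ioc d p, lam k * meanEntry lam Phat (e k) := by
      rw [← Finset.sum_sub_distrib]
      exact Finset.sum_congr rfl fun k _ => by ring
    rw [h4]
    linarith
  · rw [← sum_fin_eq_sum_Icc p fun k => meanEntry lam Phat (e k)]
    simp_rw [he, meanEntry]
    rw [← integral_finsetSum _ fun k _ => hmint k]
    simp [meanEstimator_trace]
  · intro i hi
    have h := (hCsum (e i) ((Finset.Ioc s p).image e) ?_).2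
    · rwa [Finset.sum_image (hinj _ hsub2)] at h
    · intro hmem
      obtain ⟨j, hj, hij⟩ := Finset.mem_image.mp hmem
      have := hev j (hsub2 hj)
      rw [hij, hev i (hsub1 hi)] at this
      simp only [Finset.mem_Icc, Finset.mem_Ioc] at hi hj
      omega
  · intro j hj
    have h := (hCsum (e j) ((Finset.Icc 1 r).image e) ?_).1
    · rw [Finset.sum_image (hinj _ hsub1)] at h
      -- Symmetry of m turns the column sum into a sum along row j, where the bound by a_j applies.
      simp_rw [hCsymm _ (e j)]
      exact h
    · intro hmem
      obtain ⟨i, hi, hij⟩ := Finset.mem_image.mp hmem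
      have := hev i (hsub1 hi)
      rw [hij, hev j (hsub2 hj)] at this
      simp only [Finset.mem_Icc, Finset.mem_Ioc] at hi hj
      omega
  · intro i hi j hj
    have hci := hvc (e i)
    have hcj := hvc (e j)
    rw [hev i (hsub1 hi)] at hci
    rw [hev j (hsub2 hj)] at hcj
    have hlt : eigVar p lam (e j) < eigVar p lam (e i) := by
      rw [← NNReal.coe_lt_coe, hci, hcj]
      exact hgap i hi j hj
    have := information_inequality (n := n) hv hlt (m := meanEstimator Phat)
      (measurable_meanEstimator Phat) (meanEstimator_abs_le_one Phat) (meanEstimator_rotate Phat)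
    rw [integral_sub (hmint _) (hmint _), hci, hcj] at this
    exact this

end GaussianPCA

end

/-- Integrability is part of the conclusion because Bochner integrals default to 0 otherwise. The
infimum is taken in `EReal`, where it is a true greatest lower bound without side conditions. -/
theorem mainTheorem4 (p d n : ℕ) (hn : 1 ≤ n) (hd : 1 ≤ d) (hdp : d < p)
    (lam : ℕ → ℝ) (hanti : AntitoneOn lam (Set.Icc 1 p)) (hpos : 0 < lam p)
    (hgap₁ : lam (d + 1) < lam 1) (hgap₂ : lam p < lam d)
    (r s : ℕ)
    (hr : IsGreatest {i : ℕ | 1 ≤ i ∧ i ≤ d ∧ lam (d + 1) < lam i} r)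
    (hs : IsLeast {k : ℕ | d ≤ k ∧ k < p ∧ lam (k + 1) < lam d} s)
    (μ : ℝ) (hμ : μ ∈ Set.Icc (lam (d + 1)) (lam d)) :
    (∀ Phat : GaussianPCA.Estimator p d n,
      (∀ U : GaussianPCA.OGroup p, Integrable
        (fun X => GaussianPCA.excessRisk d lam U (Phat.1 X)) (GaussianPCA.sampleLaw n lam U)) ∧
      Integrable (GaussianPCA.expectedExcessRisk lam Phat) (GaussianPCA.haarO p)) ∧
    ∃ M : ℝ, IsGreatest (GaussianPCA.objectiveValues p n r s lam μ) M ∧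
      ((1 / 3 * M : ℝ) : EReal) ≤
        ⨅ Phat : GaussianPCA.Estimator p d n,
          ((GaussianPCA.averagedExcessRisk lam Phat : ℝ) : EReal) := by
  obtain ⟨⟨-, hrd, hrgap⟩, -⟩ := hr
  obtain ⟨⟨hds, -, -⟩, -⟩ := hs
  have hle : ∀ {k l : ℕ}, 1 ≤ k → k ≤ l → l ≤ p → lam l ≤ lam k := fun hk hkl hl =>
    hanti ⟨hk, hkl.trans hl⟩ ⟨hk.trans hkl, hl⟩ hkl
  have hposI : ∀ k ∈ Finset.Icc 1 p, 0 < lam k := fun k hk => by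
    obtain ⟨h1, h2⟩ := Finset.mem_Icc.mp hk
    exact hpos.trans_le (hle h1 h2 le_rfl)
  have hpos' : ∀ k : Fin p, 0 < lam (k.val + 1) := fun k =>
    hposI _ (Finset.mem_Icc.mpr ⟨by omega, k.isLt⟩)
  have hup : ∀ i ∈ Finset.Icc 1 d, μ ≤ lam i := fun i hi => by
    obtain ⟨h1, h2⟩ := Finset.mem_Icc.mp hi
    exact hμ.2.trans (hle h1 h2 hdp.le)
  have hlow : ∀ j ∈ Finset.Ioc d p, lam j ≤ μ := fun j hj => by
    obtain ⟨h1, h2⟩ := Finset.mem_Ioc.mp hj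
    exact (hle (by omega) h1 h2).trans hμ.1
  have hgap : ∀ i ∈ Finset.Icc 1 r, ∀ j ∈ Finset.Ioc s p, lam j < lam i := fun i hi j hj => by
    obtain ⟨h1, h2⟩ := Finset.mem_Icc.mp hi
    obtain ⟨h3, h4⟩ := Finset.mem_Ioc.mp hj
    calc lam j ≤ lam (d + 1) := hle (by omega) (by omega) h4
      _ < lam r := hrgap
      _ ≤ lam i := hle h1 h2 (by omega)
  refine ⟨fun Phat => ⟨fun U => GaussianPCA.integrable_excessRisk hpos' Phat U,
    GaussianPCA.integrable_expectedExcessRisk hpos' Phat⟩, ?_⟩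
  obtain ⟨M, hM⟩ := GaussianPCA.exists_isGreatest_objectiveValues (p := p) (n := n) (r := r)
    (s := s) (lam := lam) (μ := μ)
    (fun i hi j hj => by
      have h1 := hposI i (Finset.mem_Icc.mpr ⟨(Finset.mem_Icc.mp hi).1,
        by have := (Finset.mem_Icc.mp hi).2; omega⟩)
      have h2 := hposI j (Finset.mem_Icc.mpr ⟨by have := (Finset.mem_Ioc.mp hj).1; omega,
        (Finset.mem_Ioc.mp hj).2⟩)
      have h3 := sub_pos.mpr (hgap i hi j hj)
      positivity)
    (fun j hj => hlow j (Finset.Ioc_subset_Ioc_left hds hj))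
    (fun i hi => hup i (Finset.Icc_subset_Icc_right hrd hi))
  refine ⟨M, hM, le_iInf fun Phat => ?_⟩
  obtain ⟨x, hx, rfl⟩ := hM.1
  exact EReal.coe_le_coe_iff.mpr
    (GaussianPCA.le_averagedExcessRisk hn hrd hds hdp hposI hup hlow hgap Phat hx)
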